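/- **Lemma 1.2.** Let $\varepsilon>0$, $H\in(-1/2,1/2)$ and $K(t)=K_{H,\varepsilon}(t):=(t+\varepsilon)^{H-1/2}$ for $t\ge 0$. For a function $f$ and a real measure $L$ of locally bounded variation on $[0,\infty)$ write $(f*L)(t)=\int_{[0,t]}f(t-s)\,L(ds)$. Then there is a real measure $L_\varepsilon$ of locally bounded variation on $[0,\infty)$ which is a resolvent of the first kind of $K$, i.e. $\int_{[0,t]}K(t-s)\,L_\varepsilon(ds)=1$ for all $t\ge 0$, and which is of the form $$L_\varepsilon(dt)=\frac{\delta_0(dt)}{K(0)}+\ell_\varepsilon(t)\,dt$$ with $\ell_\varepsilon$ locally integrable on $[0,\infty)$. Moreover, $K'*L_\varepsilon$ is continuously differentiable on $[0,\infty)$, and the following holds. Let $W$ be a standard Brownian motion with respect to a filtration on a probability space, let $U_0,\theta,\xi$ be real constants, let $U$ be a non-negative, progressively measurable process with continuous paths (non-negativity and continuity holding almost surely) such that, for every $t\ge 0$, almost surely, $$U_t=U_0+\int_0^t K(t-s)\,dZ_s,\qquad dZ_t=\theta\,dt+\xi\sqrt{U_t}\,dW_t ,$$ where $\int_0^t h(s)\,dZ_s=\int_0^t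 h(s)\theta\,ds+\int_0^t h(s)\xi\sqrt{U_s}\,dW_s$, the last integral being an Itô integral. Then the integral $\int_0^tK'(t-s)\,dZ_s$ exists for every $t\ge0$, the process it defines has a version with almost surely continuous paths which satisfies, almost surely, for all $t\ge 0$, $$\int_0^t K'(t-s)\,dZ_s=-\Big(\frac12-H\Big)\varepsilon^{-1}(U_t-U_0)+\int_0^t (K'*L_\varepsilon)'(t-s)\,(U_s-U_0)\,ds ,$$ and, for every fixed $t\ge0$, every version of the integral on the left satisfies this identity almost surely. -/

import Mathlib

open MeasureTheory ProbabilityTheory Set Filter Topology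
open scoped NNReal ENNReal

/-! ### Kernels, measures of locally bounded variation, resolvents of the first kind -/

/-- The shifted fractional kernel `t ↦ (t + ε) ^ (H - 1/2)`. -/
noncomputable def shiftedKernel (H ε : ℝ) (t : ℝ) : ℝ := (t + ε) ^ (H - 1 / 2)

/-- A real measure of locally bounded variation on `[0, ∞)`, given as the difference of two
positive Borel measures that are finite on bounded sets. (Both measures are allowed to be infinite
on `[0, ∞)`, so that such an object need not be a signed measure on the whole half-line.) -/
structure LocBVMeasure where
  pos : Measure ℝ
  neg : Measure ℝ
  pos_locallyFinite : IsLocallyFiniteMeasure pos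
  neg_locallyFinite : IsLocallyFiniteMeasure neg
  pos_Iio : pos (Iio 0) = 0
  neg_Iio : neg (Iio 0) = 0

/-- The value `L(A)` on a bounded Borel set `A`. -/
noncomputable def LocBVMeasure.eval (L : LocBVMeasure) (A : Set ℝ) : ℝ :=
  L.pos.real A - L.neg.real A

/-- The convolution `(f * L)(t) = ∫_{[0,t]} f(t - s) L(ds)`. -/
noncomputable def LocBVMeasure.conv (f : ℝ → ℝ) (L : LocBVMeasure) (t : ℝ) : ℝ :=
  (∫ s in Icc 0 t, f (t - s) ∂L.pos) - ∫ s in Icc 0 t, f (t - s) ∂L.neg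

/-- `L` is a resolvent of the first kind of the kernel `K`:
`∫_{[0,t]} K(t - s) L(ds) = 1` for every `t ≥ 0`. -/
def IsResolventFirstKind (K : ℝ → ℝ) (L : LocBVMeasure) : Prop :=
  ∀ t : ℝ, 0 ≤ t →
    IntegrableOn (fun s => K (t - s)) (Icc 0 t) L.pos ∧
    IntegrableOn (fun s => K (t - s)) (Icc 0 t) L.neg ∧
    LocBVMeasure.conv K L t = 1

/-- `L(dt) = c δ₀(dt) + ℓ(t) dt` on `[0, ∞)`. -/
def LocBVMeasure.HasForm (L : LocBVMeasure) (c : ℝ) (ℓ : ℝ → ℝ) : Prop :=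
  ∀ A : Set ℝ, MeasurableSet A → Bornology.IsBounded A → A ⊆ Ici 0 →
    L.eval A = A.indicator (fun _ => c) 0 + ∫ t in A, ℓ t

/-! ### Brownian motion of a filtration and the Itô integral -/

section Ito

variable {Ω : Type*} {mΩ : MeasurableSpace Ω}

/-- `W` is a standard Brownian motion with respect to the filtration `ℱ`. -/
structure IsFiltrationBrownian (μ : Measure Ω) (ℱ : Filtration ℝ≥0 mΩ) (W : ℝ≥0 → Ω → ℝ) :
    Prop where
  brownian : IsBrownianReal W μ
  adapted : StronglyAdapted ℱ W
  indep : ∀ s t : ℝ≥0, s ≤ t →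
    Indep (MeasurableSpace.comap (fun ω => W t ω - W s ω) inferInstance) (ℱ s) μ

/-- A simple process `∑_{i < n} cᵢ 1_{(tᵢ, tᵢ₊₁]}` with `t₀ ≤ t₁ ≤ …` and each `cᵢ` bounded and
`ℱ_{tᵢ}`-measurable. -/
structure ItoSimpleProcess (ℱ : Filtration ℝ≥0 mΩ) where
  n : ℕ
  time : ℕ → ℝ≥0
  time_mono : Monotone time
  coeff : ℕ → Ω → ℝ
  coeff_meas : ∀ i, StronglyMeasurable[ℱ (time i)] (coeff i)
  coeff_bdd : ∀ i, ∃ C : ℝ, ∀ ω, |coeff i ω| ≤ C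

/-- The value of a simple process at time `s`. -/
noncomputable def ItoSimpleProcess.val {ℱ : Filtration ℝ≥0 mΩ} (φ : ItoSimpleProcess ℱ)
    (s : ℝ≥0) (ω : Ω) : ℝ :=
  ∑ i ∈ Finset.range φ.n, (Ioc (φ.time i) (φ.time (i + 1))).indicator (fun _ => φ.coeff i ω) s

/-- The elementary integral `∑_{i < n} cᵢ (W_{tᵢ₊₁ ∧ t} - W_{tᵢ ∧ t})`. -/
noncomputable def ItoSimpleProcess.integral {ℱ : Filtration ℝ≥0 mΩ} (φ : ItoSimpleProcess ℱ)
    (W : ℝ≥0 → Ω → ℝ) (t : ℝ≥0) (ω : Ω) : ℝ :=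
  ∑ i ∈ Finset.range φ.n,
    φ.coeff i ω * (W (min (φ.time (i + 1)) t) ω - W (min (φ.time i) t) ω)

/-- The random variable `J` is (a version of) the Itô integral `∫_0^t Y_s dW_s`: the integrand is
progressively measurable with `∫_0^t Y_s² ds < ∞` a.s., and `J` is the limit in probability of the
elementary integrals of simple processes `φₙ` such that `∫_0^t (φₙ(s) - Y_s)² ds → 0` in
probability. -/
def IsItoIntegral (μ : Measure Ω) (ℱ : Filtration ℝ≥0 mΩ) (W Y : ℝ≥0 → Ω → ℝ) (t : ℝ≥0)
    (J : Ω → ℝ) : Prop :=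
  IsStronglyProgressive ℱ Y ∧
  (∀ᵐ ω ∂μ, ∫⁻ s in Icc (0 : ℝ) t, ENNReal.ofReal (Y s.toNNReal ω ^ 2) < ∞) ∧
  ∃ φ : ℕ → ItoSimpleProcess ℱ,
    (∀ δ : ℝ≥0∞, 0 < δ → Tendsto (fun n => μ {ω | δ ≤ ∫⁻ s in Icc (0 : ℝ) t,
      ENNReal.ofReal (((φ n).val s.toNNReal ω - Y s.toNNReal ω) ^ 2)}) atTop (𝓝 0)) ∧
    TendstoInMeasure μ (fun n => (φ n).integral W t) atTop J

/-- The random variable `X` is (a version of) `∫_0^t h(s) dZ_s`, where `dZ_s = b_s ds + σ_s dW_s`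
and `h` is deterministic, that is `X = ∫_0^t h(s) b_s ds + ∫_0^t h(s) σ_s dW_s` a.s. -/
def IsItoProcessIntegral (μ : Measure Ω) (ℱ : Filtration ℝ≥0 mΩ) (W b σ : ℝ≥0 → Ω → ℝ)
    (h : ℝ → ℝ) (t : ℝ≥0) (X : Ω → ℝ) : Prop :=
  (∀ᵐ ω ∂μ, IntervalIntegrable (fun s : ℝ => h s * b s.toNNReal ω) volume 0 t) ∧
  ∃ J : Ω → ℝ, IsItoIntegral μ ℱ W (fun s ω => h s * σ s ω) t J ∧
    ∀ᵐ ω ∂μ, X ω = (∫ s in (0 : ℝ)..t, h s * b s.toNNReal ω) + J ω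

/-- `X` is (a version of) `∫_0^t h(s) dZ_s` for `dZ_s = θ ds + ξ √U_s dW_s`. -/
def IsZIntegral (μ : Measure Ω) (ℱ : Filtration ℝ≥0 mΩ) (W : ℝ≥0 → Ω → ℝ) (θ ξ : ℝ)
    (U : ℝ≥0 → Ω → ℝ) (h : ℝ → ℝ) (t : ℝ≥0) (X : Ω → ℝ) : Prop :=
  IsItoProcessIntegral μ ℱ W (fun _ _ => θ) (fun s ω => ξ * √(U s ω)) h t X

/-- `U` is a non-negative continuous solution of the stochastic Volterra equation
`U_t = U₀ + ∫_0^t K(t - s) θ ds + ∫_0^t K(t - s) ξ √U_s dW_s`, `t ≥ 0`,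
with the shifted fractional kernel `K(t) = (t + ε) ^ (H - 1/2)`. -/
structure IsShiftedSpotVariance (μ : Measure Ω) (ℱ : Filtration ℝ≥0 mΩ) (W : ℝ≥0 → Ω → ℝ)
    (H ε U₀ θ ξ : ℝ) (U : ℝ≥0 → Ω → ℝ) : Prop where
  progressive : IsStronglyProgressive ℱ U
  continuous : ∀ᵐ ω ∂μ, Continuous fun t => U t ω
  nonneg : ∀ᵐ ω ∂μ, ∀ t, 0 ≤ U t ω
  equation : ∀ t : ℝ≥0, IsZIntegral μ ℱ W θ ξ U (fun s => shiftedKernel H ε (t - s)) t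
    (fun ω => U t ω - U₀)

end Ito

/-!
# Resolvent of the first kind and the drift term of the shifted fractional Volterra equation

Write `K` for the shifted kernel, `f * g` for the convolution on the half-line, `c = 1 / K(0)`.

*Deterministic part.* `K` is `C²` on `[0, ∞)` and `K'` is bounded there, so the Volterra equation of
the second kind `c K' + K(0) ℓ + K' * ℓ = 0` has a continuous solution `ℓ`
(`exists_volterra_solution`). Its left-hand side is the derivative of `c K + K * ℓ`, whose value at
`0` is `1`; hence `L = c δ₀ + ℓ dt` is a resolvent of the first kind. The same equation reads
`g := K' * L = -K(0) ℓ`, and the Leibniz rule `hasDerivWithinAt_volterraConv` shows that `ℓ`, hence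
`g`, is `C¹`. Differentiating `ℓ * K = 1 - c K` gives the kernel identity `K' = g(0) K + g' * K`
(`exists_resolvent_density`).

*Stochastic part.* Since `U - U₀ = K * dZ`, the claim is the kernel identity convolved with `dZ`,
which amounts to `(g' * K) * dZ = g' * (K * dZ)`. Instead of a general stochastic Fubini theorem,
`HasItoApprox.volterra` uses Riemann sums: with `V` the martingale part of `U - U₀`, along almost
every path `∫ g'(t - s) V_s ds` is a limit
of sums `∑ w g'(t - sᵢ) V_{sᵢ}`, each of which is an Itô integral over `[0, t]` of a deterministic
kernel times `ξ √U`; these kernels are Riemann sums for `g' * K` and converge boundedly, so the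
integrals converge too (`HasItoApprox.of_tendsto_kernel`). The existence of the integral of `K'` is
obtained along the way. That every other version of it agrees almost surely is the uniqueness of
the Itô integral, `HasItoApprox.ae_eq`, which follows from the isometry for simple processes after
truncation (`IsFiltrationBrownian.measure_sum_ge_le`).
-/

/-! ### Convolution on the half-line and Volterra equations -/

/-- The convolution `∫₀ᵗ a(t - s) b(s) ds`. For `t ≥ 0` only the values of `a` and `b` on `[0, t]`
matter. -/
noncomputable def volterraConv (a b : ℝ → ℝ) (t : ℝ) : ℝ := ∫ s in (0 : ℝ)..t, a (t - s) * b s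

lemma volterraConv_comm (a b : ℝ → ℝ) (t : ℝ) : volterraConv a b t = volterraConv b a t := by
  have := intervalIntegral.integral_comp_sub_left (a := 0) (b := t) (fun s => a (t - s) * b s) t
  simp only [sub_self, sub_zero, sub_sub_cancel] at this
  rw [volterraConv, ← this, volterraConv]
  simp only [mul_comm]

lemma volterraConv_congr {a a' b b' : ℝ → ℝ} (ha : EqOn a a' (Ici 0)) (hb : EqOn b b' (Ici 0))
    {t : ℝ} (ht : 0 ≤ t) : volterraConv a b t = volterraConv a' b' t := by
  refine intervalIntegral.integral_congr fun s hs => ?_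
  rw [uIcc_of_le ht] at hs
  simp only [ha (show t - s ∈ Ici 0 from sub_nonneg.2 hs.2), hb (show s ∈ Ici 0 from hs.1)]

lemma volterraConv_zero (a b : ℝ → ℝ) : volterraConv a b 0 = 0 := by simp [volterraConv]

lemma continuous_volterraConv {a b : ℝ → ℝ} (ha : Continuous a) (hb : Continuous b) :
    Continuous (volterraConv a b) :=
  intervalIntegral.continuous_parametric_intervalIntegral_of_continuous (by fun_prop) continuous_id

/-- A function continuous on `[0, ∞)` extends to a continuous function on `ℝ`, constant on
`(-∞, 0]`. -/
lemma continuous_comp_max {b : ℝ → ℝ} (hb : ContinuousOn b (Ici 0)) :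
    Continuous fun t => b (max t 0) :=
  hb.comp_continuous (by fun_prop) fun t => le_max_right t 0

lemma eqOn_comp_max (b : ℝ → ℝ) : EqOn b (fun t => b (max t 0)) (Ici 0) := fun t ht => by
  simp only [max_eq_left (show (0 : ℝ) ≤ t from ht)]

lemma continuousOn_volterraConv {a b : ℝ → ℝ} (ha : ContinuousOn a (Ici 0))
    (hb : ContinuousOn b (Ici 0)) : ContinuousOn (volterraConv a b) (Ici 0) :=
  (continuous_volterraConv (continuous_comp_max ha) (continuous_comp_max hb)).continuousOn.congr
    fun _ ht => volterraConv_congr (eqOn_comp_max a) (eqOn_comp_max b) ht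

/-- Fubini's theorem on the triangle `0 ≤ s ≤ r ≤ t`. -/
lemma integral_volterraConv {a b : ℝ → ℝ} (ha : Continuous a) (hb : Continuous b) {t : ℝ}
    (ht : 0 ≤ t) :
    ∫ r in (0 : ℝ)..t, volterraConv a b r =
      ∫ s in (0 : ℝ)..t, (∫ r in (0 : ℝ)..t - s, a r) * b s := by
  have hF : Continuous fun p : ℝ × ℝ => a (p.1 - p.2) * b p.2 := by fun_prop
  let S : Set (ℝ × ℝ) := {p | p.2 ≤ p.1}
  have hS : MeasurableSet S := measurableSet_le measurable_snd measurable_fst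
  have hint : Integrable (Function.uncurry fun r s : ℝ => S.indicator
      (fun p : ℝ × ℝ => a (p.1 - p.2) * b p.2) (r, s))
      ((volume.restrict (Ioc 0 t)).prod (volume.restrict (Ioc 0 t))) := by
    have : Integrable (fun p : ℝ × ℝ => a (p.1 - p.2) * b p.2)
        ((volume.restrict (Ioc 0 t)).prod (volume.restrict (Ioc 0 t))) := by
      rw [Measure.prod_restrict]
      exact (hF.continuousOn.integrableOn_compact
        ((isCompact_Icc (a := (0 : ℝ)) (b := t)).prod
          (isCompact_Icc (a := (0 : ℝ)) (b := t)))).mono_set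
        (prod_mono Ioc_subset_Icc_self Ioc_subset_Icc_self)
    exact this.indicator hS
  have hswap := integral_integral_swap hint
  rw [intervalIntegral.integral_of_le ht, intervalIntegral.integral_of_le ht]
  have h1 : ∀ r ∈ Ioc 0 t, ∫ s in Ioc 0 t, S.indicator
      (fun p : ℝ × ℝ => a (p.1 - p.2) * b p.2) (r, s) = volterraConv a b r := by
    intro r hr
    rw [volterraConv, intervalIntegral.integral_of_le hr.1.le,
      show Ioc 0 r = Ioc 0 t ∩ Iic r by
        ext x; simp only [mem_inter_iff, mem_Ioc, mem_Iic]
        exact ⟨fun h => ⟨⟨h.1, h.2.trans hr.2⟩, h.2⟩, fun h => ⟨h.1.1, h.2⟩⟩,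
      ← setIntegral_indicator measurableSet_Iic]
    rfl
  have h2 : ∀ s ∈ Ioc 0 t, ∫ r in Ioc 0 t, S.indicator
      (fun p : ℝ × ℝ => a (p.1 - p.2) * b p.2) (r, s) = (∫ r in (0 : ℝ)..t - s, a r) * b s := by
    intro s hs
    have := intervalIntegral.integral_comp_sub_right (a := s) (b := t) (fun r => a r) s
    rw [sub_self] at this
    rw [← this, ← intervalIntegral.integral_mul_const, intervalIntegral.integral_of_le hs.2,
      ← integral_Icc_eq_integral_Ioc (x := s),
      show Icc s t = Ioc 0 t ∩ Ici s by
        ext x; simp only [mem_Icc, mem_inter_iff, mem_Ioc, mem_Ici]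
        exact ⟨fun h => ⟨⟨hs.1.trans_le h.1, h.2⟩, h.1⟩, fun h => ⟨h.2, h.1.2⟩⟩,
      ← setIntegral_indicator measurableSet_Ici]
    rfl
  rw [← setIntegral_congr_fun measurableSet_Ioc h1, ← setIntegral_congr_fun measurableSet_Ioc h2]
  exact hswap

lemma eq_add_integral_of_hasDerivWithinAt {a a' : ℝ → ℝ}
    (ha : ∀ t ∈ Ici (0 : ℝ), HasDerivWithinAt a (a' t) (Ici 0) t) (ha' : ContinuousOn a' (Ici 0))
    {t : ℝ} (ht : 0 ≤ t) : a t = a 0 + ∫ r in (0 : ℝ)..t, a' r := by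
  rw [intervalIntegral.integral_eq_sub_of_hasDeriv_right_of_le ht]
  · ring
  · exact fun x hx => ((ha x hx.1).continuousWithinAt).mono Icc_subset_Ici_self
  · exact fun x hx => (ha x hx.1.le).mono fun y hy => hx.1.le.trans (le_of_lt hy)
  · exact (ha'.mono (by rw [uIcc_of_le ht]; exact Icc_subset_Ici_self)).intervalIntegrable

lemma volterraConv_eq_integral {a a' b : ℝ → ℝ}
    (ha : ∀ t ∈ Ici (0 : ℝ), HasDerivWithinAt a (a' t) (Ici 0) t) (ha' : ContinuousOn a' (Ici 0))
    (hb : ContinuousOn b (Ici 0)) {t : ℝ} (ht : 0 ≤ t) :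
    volterraConv a b t = ∫ r in (0 : ℝ)..t, (a 0 * b r + volterraConv a' b r) := by
  have hba := continuous_comp_max hb
  have haa := continuous_comp_max ha'
  have hV : ContinuousOn (volterraConv a' b) (uIcc 0 t) :=
    (continuousOn_volterraConv ha' hb).mono (by rw [uIcc_of_le ht]; exact Icc_subset_Ici_self)
  have hbt : ContinuousOn b (uIcc 0 t) := hb.mono (by rw [uIcc_of_le ht]; exact Icc_subset_Ici_self)
  have hab : IntervalIntegrable (fun r => a 0 * b r) volume 0 t :=
    (continuousOn_const.mul hbt).intervalIntegrable
  rw [intervalIntegral.integral_add hab hV.intervalIntegrable]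
  have h1 : ∫ r in (0 : ℝ)..t, volterraConv a' b r =
      ∫ s in (0 : ℝ)..t, (a (t - s) - a 0) * b s := by
    rw [intervalIntegral.integral_congr (g := volterraConv (fun t => a' (max t 0))
      (fun t => b (max t 0))), integral_volterraConv haa hba ht]
    · refine intervalIntegral.integral_congr fun s hs => ?_
      rw [uIcc_of_le ht] at hs
      have hs' : 0 ≤ t - s := sub_nonneg.2 hs.2
      simp only [max_eq_left hs.1]
      rw [eq_add_integral_of_hasDerivWithinAt ha ha' hs', add_sub_cancel_left]
      congr 1
      refine intervalIntegral.integral_congr fun r hr => ?_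
      rw [uIcc_of_le hs'] at hr
      simp only [max_eq_left hr.1]
    · intro r hr
      rw [uIcc_of_le ht] at hr
      exact volterraConv_congr (eqOn_comp_max a') (eqOn_comp_max b) hr.1
  rw [h1, ← intervalIntegral.integral_add]
  · exact intervalIntegral.integral_congr fun s _ => by ring
  · exact hab
  · refine ContinuousOn.intervalIntegrable
      (ContinuousOn.mul (ContinuousOn.sub ?_ continuousOn_const) hbt)
    refine ContinuousOn.comp (t := Ici 0) (fun x hx => (ha x hx).continuousWithinAt)
      (by fun_prop) ?_
    intro s hs
    rw [uIcc_of_le ht] at hs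
    exact sub_nonneg.2 hs.2

lemma hasDerivWithinAt_integral {q : ℝ → ℝ} (hq : ContinuousOn q (Ici 0)) {t : ℝ} (ht : 0 ≤ t) :
    HasDerivWithinAt (fun t => ∫ r in (0 : ℝ)..t, q r) (q t) (Ici 0) t := by
  have h := ((continuous_comp_max hq).integral_hasStrictDerivAt 0 t).hasDerivAt.hasDerivWithinAt
    (s := Ici 0)
  simp only [max_eq_left ht] at h
  refine h.congr_of_mem (fun x hx => ?_) ht
  refine intervalIntegral.integral_congr fun r hr => ?_
  rw [uIcc_of_le hx] at hr
  simp only [max_eq_left hr.1]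

/-- The Leibniz rule `(a * b)' = a(0) b + a' * b` for the convolution product on the half-line. -/
lemma hasDerivWithinAt_volterraConv {a a' b : ℝ → ℝ}
    (ha : ∀ t ∈ Ici (0 : ℝ), HasDerivWithinAt a (a' t) (Ici 0) t) (ha' : ContinuousOn a' (Ici 0))
    (hb : ContinuousOn b (Ici 0)) {t : ℝ} (ht : 0 ≤ t) :
    HasDerivWithinAt (volterraConv a b) (a 0 * b t + volterraConv a' b t) (Ici 0) t :=
  (hasDerivWithinAt_integral (q := fun r => a 0 * b r + volterraConv a' b r)
    ((continuousOn_const.mul hb).add (continuousOn_volterraConv ha' hb)) ht).congr_of_mem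
    (fun _ hx => volterraConv_eq_integral ha ha' hb hx) ht

open BoundedContinuousFunction in
/-- A linear Volterra equation of the second kind with bounded continuous data has a continuous
solution. The solution is sought as `exp (λ t) m t` with `m` bounded: for `λ` large, the equation
for `m` is a fixed point equation for a contraction of the space of bounded continuous
functions. -/
lemma exists_volterra_solution {f k : ℝ → ℝ} (hf : ContinuousOn f (Ici 0))
    (hk : ContinuousOn k (Ici 0)) {C : ℝ} (hfC : ∀ t, 0 ≤ t → |f t| ≤ C)
    (hkC : ∀ t, 0 ≤ t → |k t| ≤ C) :
    ∃ ℓ : ℝ → ℝ, Continuous ℓ ∧ ∀ t, 0 ≤ t → ℓ t = f t + volterraConv k ℓ t := by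
  have hC : 0 ≤ C := (abs_nonneg _).trans (hfC 0 le_rfl)
  obtain ⟨c, hc⟩ : ∃ c : ℝ, c = 2 * C + 1 := ⟨_, rfl⟩
  have hc0 : 0 < c := by linarith
  let F : ℝ → ℝ := fun t => Real.exp (-(c * max t 0)) * f (max t 0)
  let G : ℝ → ℝ := fun t => Real.exp (-(c * max t 0)) * k (max t 0)
  have hF : Continuous F := (by fun_prop : Continuous fun t : ℝ => Real.exp (-(c * max t 0))).mul
    (continuous_comp_max hf)
  have hG : Continuous G := (by fun_prop : Continuous fun t : ℝ => Real.exp (-(c * max t 0))).mul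
    (continuous_comp_max hk)
  have hFC : ∀ t, |F t| ≤ C := fun t => by
    rw [abs_mul, abs_of_pos (Real.exp_pos _)]
    have : Real.exp (-(c * max t 0)) ≤ 1 :=
      Real.exp_le_one_iff.2 (by have := le_max_right t 0; nlinarith)
    have := hfC _ (le_max_right t 0)
    have := abs_nonneg (f (max t 0))
    nlinarith [Real.exp_pos (-(c * max t 0))]
  -- the exponential weight makes the kernel integrable, with integral at most `C / c ≤ 1 / 2`
  have key : ∀ (m : ℝ → ℝ) (B : ℝ), 0 ≤ B → (∀ x, |m x| ≤ B) → ∀ t, 0 ≤ t →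
      |volterraConv G m t| ≤ 1 / 2 * B := by
    intro m B hB hm t ht
    rw [volterraConv_comm, volterraConv]
    have hint : IntervalIntegrable (fun s => (B * C) * Real.exp (-(c * s))) volume 0 t :=
      (by fun_prop : Continuous fun s => (B * C) * Real.exp (-(c * s))).intervalIntegrable 0 t
    have h1 : ‖∫ s in (0 : ℝ)..t, m (t - s) * G s‖ ≤
        ∫ s in (0 : ℝ)..t, (B * C) * Real.exp (-(c * s)) := by
      refine intervalIntegral.norm_integral_le_of_norm_le ht (ae_of_all _ fun s hs => ?_) hint
      rw [Real.norm_eq_abs, abs_mul, mul_assoc]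
      refine mul_le_mul (hm _) ?_ (abs_nonneg _) hB
      simp only [G]
      rw [abs_mul, abs_of_pos (Real.exp_pos _), max_eq_left hs.1.le, mul_comm]
      exact mul_le_mul_of_nonneg_right (hkC _ hs.1.le) (Real.exp_pos _).le
    rw [← Real.norm_eq_abs]
    refine h1.trans ?_
    have h2 : ∫ s in (0 : ℝ)..t, (B * C) * Real.exp (-(c * s)) =
        (B * C) * (-c⁻¹ * Real.exp (-(c * t))) - (B * C) * (-c⁻¹ * Real.exp (-(c * 0))) := by
      refine intervalIntegral.integral_eq_sub_of_hasDerivAt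
        (f := fun s => (B * C) * (-c⁻¹ * Real.exp (-(c * s)))) (fun s _ => ?_) hint
      have := (((((hasDerivAt_id s).const_mul c).neg).exp).const_mul (-c⁻¹)).const_mul (B * C)
      refine HasDerivAt.congr_deriv (f := fun s => (B * C) * (-c⁻¹ * Real.exp (-(c * s)))) this ?_
      simp only [Pi.neg_apply, id]
      field_simp
    rw [h2]
    have h3 : C * c⁻¹ ≤ 1 / 2 := by
      rw [← div_eq_mul_inv, div_le_iff₀ hc0]; linarith
    have h4 : 0 ≤ B * C * c⁻¹ * Real.exp (-(c * t)) := by positivity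
    have h5 : B * (C * c⁻¹) ≤ B * (1 / 2) := mul_le_mul_of_nonneg_left h3 hB
    simp only [mul_zero, neg_zero, Real.exp_zero]
    nlinarith
  have hmb : ∀ (m : ℝ →ᵇ ℝ) x, |m x| ≤ ‖m‖ := fun m x => m.norm_coe_le_norm x
  let Φ : (ℝ →ᵇ ℝ) → (ℝ →ᵇ ℝ) := fun m =>
    BoundedContinuousFunction.ofNormedAddCommGroup (fun t => F t + volterraConv G m (max t 0))
      (hF.add ((continuous_volterraConv hG m.continuous).comp (by fun_prop)))
      (C + 1 / 2 * ‖m‖) (fun t => (abs_add_le _ _).trans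
        (add_le_add (hFC t) (key m ‖m‖ (norm_nonneg _) (hmb m) _ (le_max_right t 0))))
  have hΦ : ContractingWith (1 / 2) Φ := by
    refine ⟨NNReal.half_lt_self one_ne_zero, LipschitzWith.of_dist_le_mul fun m n => ?_⟩
    rw [BoundedContinuousFunction.dist_le (by positivity)]
    intro t
    have : Φ m t - Φ n t = volterraConv G (fun x => m x - n x) (max t 0) := by
      simp only [Φ, BoundedContinuousFunction.coe_ofNormedAddCommGroup, volterraConv]
      rw [add_sub_add_left_eq_sub, ← intervalIntegral.integral_sub]
      · exact intervalIntegral.integral_congr fun s _ => by ring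
      · exact Continuous.intervalIntegrable (by fun_prop) _ _
      · exact Continuous.intervalIntegrable (by fun_prop) _ _
    rw [Real.dist_eq, this]
    refine (key _ (dist m n) dist_nonneg (fun x => ?_) _ (le_max_right t 0)).trans ?_
    · rw [← Real.dist_eq]; exact BoundedContinuousFunction.dist_coe_le_dist x
    · simp
  obtain ⟨m, hm⟩ : ∃ m, Φ m = m := ⟨_, hΦ.fixedPoint_isFixedPt⟩
  refine ⟨fun t => Real.exp (c * t) * m t, by fun_prop, fun t ht => ?_⟩
  have hmt : m t = F t + volterraConv G m t := by
    conv_lhs => rw [← hm]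
    simp only [Φ, BoundedContinuousFunction.coe_ofNormedAddCommGroup, max_eq_left ht]
  simp only
  rw [hmt, mul_add]
  congr 1
  · simp only [F, max_eq_left ht]
    rw [← mul_assoc, ← Real.exp_add]; simp
  · simp only [volterraConv]
    rw [← intervalIntegral.integral_const_mul]
    refine intervalIntegral.integral_congr fun s hs => ?_
    rw [uIcc_of_le ht] at hs
    simp only [G, max_eq_left (sub_nonneg.2 hs.2)]
    rw [show c * s = c * t + -(c * (t - s)) by ring, Real.exp_add]
    ring

/-- The density of the resolvent of the first kind of a `C²` kernel `K` on the half-line: a `C¹`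
function `ℓ` with `K / K(0) + K * ℓ = 1`. The function `K' / K(0) + K' * ℓ` is then `-K(0) ℓ`, and
differentiating `ℓ * K = 1 - K / K(0)` expresses `K'` through `K`. -/
lemma exists_resolvent_density {K K' K'' : ℝ → ℝ}
    (hK : ∀ t ∈ Ici (0 : ℝ), HasDerivWithinAt K (K' t) (Ici 0) t)
    (hK' : ∀ t ∈ Ici (0 : ℝ), HasDerivWithinAt K' (K'' t) (Ici 0) t)
    (hK'' : ContinuousOn K'' (Ici 0)) (hK0 : K 0 ≠ 0) {C : ℝ} (hC : ∀ t, 0 ≤ t → |K' t| ≤ C) :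
    ∃ ℓ ℓ' : ℝ → ℝ, Continuous ℓ ∧ ContinuousOn ℓ' (Ici 0) ∧
      (∀ t ∈ Ici (0 : ℝ), HasDerivWithinAt ℓ (ℓ' t) (Ici 0) t) ∧
      (∀ t, 0 ≤ t → (K 0)⁻¹ * K t + volterraConv K ℓ t = 1) ∧
      (∀ t, 0 ≤ t → (K 0)⁻¹ * K' t + volterraConv K' ℓ t = -K 0 * ℓ t) ∧
      (∀ t, 0 ≤ t → K' t = -K 0 * ℓ 0 * K t + volterraConv (fun s => -K 0 * ℓ' s) K t) := by
  have hKc : ContinuousOn K (Ici 0) := fun t ht => (hK t ht).continuousWithinAt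
  have hKc' : ContinuousOn K' (Ici 0) := fun t ht => (hK' t ht).continuousWithinAt
  obtain ⟨ℓ, hℓ, hℓeq⟩ := exists_volterra_solution (f := fun t => -(K 0)⁻¹ ^ 2 * K' t)
    (k := fun t => -(K 0)⁻¹ * K' t) (C := max (|(K 0)⁻¹ ^ 2| * C) (|(K 0)⁻¹| * C))
    (continuousOn_const.mul hKc') (continuousOn_const.mul hKc')
    (fun t ht => by
      rw [abs_mul, abs_neg]
      exact le_max_of_le_left (mul_le_mul_of_nonneg_left (hC t ht) (abs_nonneg _)))
    (fun t ht => by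
      rw [abs_mul, abs_neg]
      exact le_max_of_le_right (mul_le_mul_of_nonneg_left (hC t ht) (abs_nonneg _)))
  have hconst : ∀ (c : ℝ) (a b : ℝ → ℝ) (t : ℝ),
      volterraConv (fun s => c * a s) b t = c * volterraConv a b t := fun c a b t => by
    simp only [volterraConv, mul_assoc, intervalIntegral.integral_const_mul]
  have hg : ∀ t, 0 ≤ t → (K 0)⁻¹ * K' t + volterraConv K' ℓ t = -K 0 * ℓ t := by
    intro t ht
    rw [hℓeq t ht, hconst]
    field_simp
    ring
  have hℓd : ∀ t ∈ Ici (0 : ℝ), HasDerivWithinAt ℓ (-(K 0)⁻¹ ^ 2 * K'' t +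
      -(K 0)⁻¹ * (K' 0 * ℓ t + volterraConv K'' ℓ t)) (Ici 0) t := by
    intro t ht
    refine (((hK' t ht).const_mul (-(K 0)⁻¹ ^ 2)).add
      ((hasDerivWithinAt_volterraConv hK' hK'' hℓ.continuousOn ht).const_mul
        (-(K 0)⁻¹))).congr_of_mem (fun x hx => ?_) ht
    rw [hℓeq x hx, hconst]
    rfl
  have hℓ'c : ContinuousOn (fun t => -(K 0)⁻¹ ^ 2 * K'' t +
      -(K 0)⁻¹ * (K' 0 * ℓ t + volterraConv K'' ℓ t)) (Ici 0) :=
    (continuousOn_const.mul hK'').add (continuousOn_const.mul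
      ((continuousOn_const.mul hℓ.continuousOn).add
        (continuousOn_volterraConv hK'' hℓ.continuousOn)))
  have hres : ∀ t, 0 ≤ t → (K 0)⁻¹ * K t + volterraConv K ℓ t = 1 := by
    intro t ht
    rw [volterraConv_eq_integral hK hKc' hℓ.continuousOn ht,
      eq_add_integral_of_hasDerivWithinAt hK hKc' ht, mul_add, inv_mul_cancel₀ hK0, add_assoc,
      ← intervalIntegral.integral_const_mul, ← intervalIntegral.integral_add]
    · rw [add_eq_left]
      refine (intervalIntegral.integral_congr (g := fun _ => (0 : ℝ)) fun r hr => ?_).trans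
        intervalIntegral.integral_zero
      rw [uIcc_of_le ht] at hr
      have := hg r hr.1
      simp only
      linarith
    · refine ContinuousOn.intervalIntegrable ((continuousOn_const.mul hKc').mono ?_)
      rw [uIcc_of_le ht]; exact Icc_subset_Ici_self
    · refine ContinuousOn.intervalIntegrable (((continuousOn_const.mul hℓ.continuousOn).add
        (continuousOn_volterraConv hKc' hℓ.continuousOn)).mono ?_)
      rw [uIcc_of_le ht]; exact Icc_subset_Ici_self
  refine ⟨ℓ, _, hℓ, hℓ'c, hℓd, hres, hg, fun t ht => ?_⟩
  have h1 := hasDerivWithinAt_volterraConv hℓd hℓ'c hKc ht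
  have h2 : HasDerivWithinAt (volterraConv ℓ K) (-((K 0)⁻¹ * K' t)) (Ici 0) t := by
    refine (((hK t ht).const_mul (K 0)⁻¹).const_sub 1).congr_of_mem (fun x hx => ?_) ht
    rw [volterraConv_comm]
    linarith [hres x hx]
  have h3 := UniqueDiffWithinAt.eq_deriv (Ici (0 : ℝ)) (uniqueDiffOn_Ici (0 : ℝ) t ht) h1 h2
  rw [hconst]
  have h4 : K' t = -K 0 * -((K 0)⁻¹ * K' t) := by field_simp
  rw [h4, ← h3]
  ring

/-! ### Measures of the form `c δ₀(dt) + ℓ(t) dt` -/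

/-- The measure `ℓ⁺(t) dt` on `[0, ∞)`. -/
noncomputable def halfLineDensity (ℓ : ℝ → ℝ) : Measure ℝ :=
  (volume.restrict (Ici 0)).withDensity fun t => ((ℓ t).toNNReal : ℝ≥0∞)

lemma isLocallyFiniteMeasure_halfLineDensity {ℓ : ℝ → ℝ} (hℓ : Continuous ℓ) :
    IsLocallyFiniteMeasure (halfLineDensity ℓ) :=
  IsLocallyFiniteMeasure.withDensity_coe (by fun_prop)

lemma halfLineDensity_Iio (ℓ : ℝ → ℝ) : halfLineDensity ℓ (Iio 0) = 0 := by
  refine withDensity_absolutelyContinuous _ _ ?_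
  rw [Measure.restrict_apply measurableSet_Iio, show Iio (0 : ℝ) ∩ Ici 0 = ∅ by ext x; simp]
  simp

lemma setIntegral_halfLineDensity {ℓ : ℝ → ℝ} (hℓ : Continuous ℓ) {A : Set ℝ}
    (hA : MeasurableSet A) (hA0 : A ⊆ Ici 0) (f : ℝ → ℝ) :
    ∫ s in A, f s ∂halfLineDensity ℓ = ∫ s in A, max (ℓ s) 0 * f s := by
  rw [halfLineDensity, setIntegral_withDensity_eq_setIntegral_smul
    (f := fun t => (ℓ t).toNNReal) hℓ.measurable.real_toNNReal _ hA,
    Measure.restrict_restrict hA, inter_eq_left.2 hA0]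
  rfl

lemma isLocallyFiniteMeasure_add {μ ν : Measure ℝ} (hμ : IsLocallyFiniteMeasure μ)
    (hν : IsLocallyFiniteMeasure ν) : IsLocallyFiniteMeasure (μ + ν) := by
  refine ⟨fun x => ?_⟩
  obtain ⟨s, hs, hs'⟩ := hμ.finiteAtNhds x
  obtain ⟨t, ht, ht'⟩ := hν.finiteAtNhds x
  refine ⟨s ∩ t, inter_mem hs ht, ?_⟩
  rw [Measure.add_apply]
  exact ENNReal.add_lt_top.2 ⟨(measure_mono inter_subset_left).trans_lt hs',
    (measure_mono inter_subset_right).trans_lt ht'⟩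

/-- The measure `c δ₀(dt) + ℓ(t) dt` on `[0, ∞)`, split into `c δ₀ + ℓ⁺ dt` and `ℓ⁻ dt`. -/
noncomputable def atomAddDensity (c : ℝ≥0) {ℓ : ℝ → ℝ} (hℓ : Continuous ℓ) : LocBVMeasure where
  pos := c • Measure.dirac 0 + halfLineDensity ℓ
  neg := halfLineDensity (fun t => -ℓ t)
  pos_locallyFinite := isLocallyFiniteMeasure_add inferInstance
    (isLocallyFiniteMeasure_halfLineDensity hℓ)
  neg_locallyFinite := isLocallyFiniteMeasure_halfLineDensity hℓ.neg
  pos_Iio := by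
    rw [Measure.add_apply, halfLineDensity_Iio, Measure.smul_apply,
      Measure.dirac_apply' _ measurableSet_Iio]
    simp
  neg_Iio := halfLineDensity_Iio _

lemma setIntegral_atomAddDensity (c : ℝ≥0) {ℓ : ℝ → ℝ} (hℓ : Continuous ℓ) {A : Set ℝ} {T : ℝ}
    (hA : MeasurableSet A) (hAT : A ⊆ Icc 0 T) {f : ℝ → ℝ} (hf : ContinuousOn f (Icc 0 T)) :
    (∫ s in A, f s ∂(atomAddDensity c hℓ).pos) - ∫ s in A, f s ∂(atomAddDensity c hℓ).neg =
      A.indicator (fun s => c * f s) 0 + ∫ s in A, f s * ℓ s := by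
  have := isLocallyFiniteMeasure_halfLineDensity hℓ
  have hfi : ∀ (ν : Measure ℝ) [IsLocallyFiniteMeasure ν], IntegrableOn f A ν := fun ν _ =>
    (hf.integrableOn_compact isCompact_Icc).mono_set hAT
  have hA0 : A ⊆ Ici 0 := hAT.trans Icc_subset_Ici_self
  simp only [atomAddDensity]
  have hi : ∀ g : ℝ → ℝ, Continuous g → IntegrableOn (fun s => g s * f s) A := fun g hg =>
    ((hg.continuousOn.mul hf).integrableOn_compact isCompact_Icc).mono_set hAT
  rw [Measure.restrict_add, integral_add_measure (hfi (c • Measure.dirac 0)) (hfi _),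
    setIntegral_halfLineDensity hℓ hA hA0,
    setIntegral_halfLineDensity (ℓ := fun t => -ℓ t) hℓ.neg hA hA0,
    add_sub_assoc,
    ← integral_sub (hi _ (by fun_prop)) (hi _ (by fun_prop))]
  congr 1
  · classical
    rw [Measure.restrict_smul, integral_smul_nnreal_measure]
    by_cases h0 : (0 : ℝ) ∈ A
    · rw [restrict_dirac' hA, if_pos h0, integral_dirac, indicator_of_mem h0]
      rfl
    · rw [restrict_dirac' hA, if_neg h0, integral_zero_measure, indicator_of_notMem h0,
        smul_zero]
  · refine integral_congr_ae (ae_of_all _ fun s => ?_)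
    simp only
    rcases le_total 0 (ℓ s) with h | h
    · rw [max_eq_left h, max_eq_right (by linarith)]; ring
    · rw [max_eq_right h, max_eq_left (by linarith)]; ring

lemma conv_atomAddDensity (c : ℝ≥0) {ℓ : ℝ → ℝ} (hℓ : Continuous ℓ) {f : ℝ → ℝ}
    (hf : ContinuousOn f (Ici 0)) {t : ℝ} (ht : 0 ≤ t) :
    LocBVMeasure.conv f (atomAddDensity c hℓ) t = c * f t + volterraConv f ℓ t := by
  have hft : ContinuousOn (fun s => f (t - s)) (Icc 0 t) :=
    hf.comp (by fun_prop) fun s hs => sub_nonneg.2 hs.2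
  rw [LocBVMeasure.conv, setIntegral_atomAddDensity c hℓ measurableSet_Icc subset_rfl hft,
    indicator_of_mem (left_mem_Icc.2 ht), sub_zero, volterraConv,
    intervalIntegral.integral_of_le ht, integral_Icc_eq_integral_Ioc]

lemma integrableOn_locBVMeasure (L : LocBVMeasure) {f : ℝ → ℝ} (hf : ContinuousOn f (Ici 0))
    (t : ℝ) : IntegrableOn (fun s => f (t - s)) (Icc 0 t) L.pos ∧
      IntegrableOn (fun s => f (t - s)) (Icc 0 t) L.neg := by
  have := L.pos_locallyFinite
  have := L.neg_locallyFinite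
  have hft : ContinuousOn (fun s => f (t - s)) (Icc 0 t) :=
    hf.comp (by fun_prop) fun s hs => sub_nonneg.2 hs.2
  exact ⟨hft.integrableOn_compact isCompact_Icc, hft.integrableOn_compact isCompact_Icc⟩

lemma hasForm_atomAddDensity (c : ℝ≥0) {ℓ : ℝ → ℝ} (hℓ : Continuous ℓ) :
    (atomAddDensity c hℓ).HasForm c ℓ := by
  intro A hA hAb hA0
  obtain ⟨T, hT⟩ := hAb.bddAbove
  have h := setIntegral_atomAddDensity c hℓ (T := T) hA (fun x hx => ⟨hA0 hx, hT hx⟩)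
    (f := fun _ => 1) continuousOn_const
  simpa [LocBVMeasure.eval] using h

/-! ### The resolvent of the shifted kernel -/

/-- For a `C²` kernel the resolvent of the first kind has the form `δ₀ / K(0) + ℓ(t) dt`. The last
clause is the identity `K' = g(0) K + g' * K` for `g = K' * L`. -/
lemma exists_resolventFirstKind {K K' K'' : ℝ → ℝ}
    (hK : ∀ t ∈ Ici (0 : ℝ), HasDerivWithinAt K (K' t) (Ici 0) t)
    (hK' : ∀ t ∈ Ici (0 : ℝ), HasDerivWithinAt K' (K'' t) (Ici 0) t)
    (hK'' : ContinuousOn K'' (Ici 0)) (hK0 : 0 < K 0) {C : ℝ} (hC : ∀ t, 0 ≤ t → |K' t| ≤ C) :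
    ∃ (L : LocBVMeasure) (ℓ g' : ℝ → ℝ), Continuous ℓ ∧ IsResolventFirstKind K L ∧
      L.HasForm (K 0)⁻¹ ℓ ∧ ContinuousOn g' (Ici 0) ∧
      (∀ t ∈ Ici (0 : ℝ), HasDerivWithinAt (LocBVMeasure.conv K' L) (g' t) (Ici 0) t) ∧
      ∀ t, 0 ≤ t → K' t = (K 0)⁻¹ * K' 0 * K t + volterraConv g' K t := by
  have hKc : ContinuousOn K (Ici 0) := fun t ht => (hK t ht).continuousWithinAt
  have hKc' : ContinuousOn K' (Ici 0) := fun t ht => (hK' t ht).continuousWithinAt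
  obtain ⟨ℓ, ℓ', hℓ, hℓ'c, hℓd, hres, hg, hK'eq⟩ :=
    exists_resolvent_density hK hK' hK'' hK0.ne' hC
  have hc : (((K 0)⁻¹.toNNReal : ℝ≥0) : ℝ) = (K 0)⁻¹ := Real.coe_toNNReal _ (inv_pos.2 hK0).le
  refine ⟨atomAddDensity (K 0)⁻¹.toNNReal hℓ, ℓ, fun t => -K 0 * ℓ' t, hℓ, fun t ht => ?_,
    by simpa only [hc] using hasForm_atomAddDensity (K 0)⁻¹.toNNReal hℓ,
    continuousOn_const.mul hℓ'c, fun t ht => ?_, fun t ht => ?_⟩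
  · obtain ⟨h1, h2⟩ := integrableOn_locBVMeasure (atomAddDensity (K 0)⁻¹.toNNReal hℓ) hKc t
    exact ⟨h1, h2, by rw [conv_atomAddDensity _ hℓ hKc ht, hc, hres t ht]⟩
  · refine ((hℓd t ht).const_mul (-K 0)).congr_of_mem (fun x hx => ?_) ht
    rw [conv_atomAddDensity _ hℓ hKc' hx, hc, hg x hx]
  · have h0 := hg 0 le_rfl
    rw [volterraConv_zero, add_zero] at h0
    rw [h0]
    exact hK'eq t ht

lemma contDiffOn_one_Ici {f f' : ℝ → ℝ}
    (hf : ∀ t ∈ Ici (0 : ℝ), HasDerivWithinAt f (f' t) (Ici 0) t) (hf' : ContinuousOn f' (Ici 0)) :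
    ContDiffOn ℝ 1 f (Ici 0) := by
  have h1 : (1 : WithTop ℕ∞) = 0 + 1 := by norm_num
  rw [h1, contDiffOn_succ_iff_derivWithin (uniqueDiffOn_Ici 0)]
  refine ⟨fun t ht => (hf t ht).differentiableWithinAt, by simp, ?_⟩
  rw [contDiffOn_zero]
  exact hf'.congr fun t ht => (hf t ht).derivWithin (uniqueDiffOn_Ici 0 t ht)

lemma hasDerivAt_shiftedKernel (H : ℝ) {ε : ℝ} {t : ℝ} (ht : 0 < t + ε) :
    HasDerivAt (shiftedKernel H ε) ((H - 1 / 2) * (t + ε) ^ (H - 1 / 2 - 1)) t := by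
  have := (((hasDerivAt_id t).add_const ε).rpow_const (p := H - 1 / 2) (Or.inl ht.ne'))
  rw [one_mul] at this
  exact this

lemma hasDerivAt_deriv_shiftedKernel (H : ℝ) {ε : ℝ} {t : ℝ} (ht : 0 < t + ε) :
    HasDerivAt (deriv (shiftedKernel H ε))
      ((H - 1 / 2) * ((H - 1 / 2 - 1) * (t + ε) ^ (H - 1 / 2 - 1 - 1))) t := by
  have := (((hasDerivAt_id t).add_const ε).rpow_const (p := H - 1 / 2 - 1)
    (Or.inl ht.ne')).const_mul (H - 1 / 2)
  have h2 : HasDerivAt (fun t : ℝ => (H - 1 / 2) * (t + ε) ^ (H - 1 / 2 - 1))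
      ((H - 1 / 2) * ((H - 1 / 2 - 1) * (t + ε) ^ (H - 1 / 2 - 1 - 1))) t := by
    rw [one_mul] at this
    exact this
  refine h2.congr_of_eventuallyEq ?_
  filter_upwards [(isOpen_lt continuous_const
    (by fun_prop : Continuous fun t => t + ε)).mem_nhds ht] with x hx
  exact (hasDerivAt_shiftedKernel H hx).deriv

/-! ### Simple processes -/

section
variable {Ω : Type*} {mΩ : MeasurableSpace Ω}

namespace ItoSimpleProcess

variable {ℱ : Filtration ℝ≥0 mΩ}

/-- The sum `∑ cᵢ (w tᵢ₊₁ - w tᵢ)`: the integral of the simple process against the increments of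
`w`. Both the values and the elementary integrals of a simple process are of this form. -/
noncomputable def incr (φ : ItoSimpleProcess ℱ) (w : ℝ≥0 → ℝ) (ω : Ω) : ℝ :=
  ∑ i ∈ Finset.range φ.n, φ.coeff i ω * (w (φ.time (i + 1)) - w (φ.time i))

lemma val_eq_incr (φ : ItoSimpleProcess ℱ) (s : ℝ≥0) (ω : Ω) :
    φ.val s ω = φ.incr (fun x => if s ≤ x then 1 else 0) ω := by
  refine Finset.sum_congr rfl fun i _ => ?_
  have := φ.time_mono (Nat.le_succ i)
  simp only [indicator_apply, mem_Ioc]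
  by_cases h1 : s ≤ φ.time i
  · have h2 : s ≤ φ.time (i + 1) := h1.trans this
    simp [h1, h2]
  · by_cases h2 : s ≤ φ.time (i + 1) <;> simp [h1, h2, not_le.1 h1]

lemma integral_eq_incr (φ : ItoSimpleProcess ℱ) (W : ℝ≥0 → Ω → ℝ) (t : ℝ≥0) (ω : Ω) :
    φ.integral W t ω = φ.incr (fun x => W (min x t) ω) ω := rfl

/-- Scalar multiple of a simple process. -/
noncomputable def smul (a : ℝ) (φ : ItoSimpleProcess ℱ) : ItoSimpleProcess ℱ where
  n := φ.n
  time := φ.time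
  time_mono := φ.time_mono
  coeff i ω := a * φ.coeff i ω
  coeff_meas i := (φ.coeff_meas i).const_mul a
  coeff_bdd i := by
    obtain ⟨C, hC⟩ := φ.coeff_bdd i
    exact ⟨|a| * C, fun ω => by rw [abs_mul]; exact mul_le_mul_of_nonneg_left (hC ω) (abs_nonneg a)⟩

lemma incr_smul (a : ℝ) (φ : ItoSimpleProcess ℱ) (w : ℝ≥0 → ℝ) (ω : Ω) :
    (φ.smul a).incr w ω = a * φ.incr w ω := by
  simp only [incr, smul, Finset.mul_sum, mul_assoc]

open Classical in
/-- The restriction of a simple process to the time interval `[0, T]`. -/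
noncomputable def restrict (φ : ItoSimpleProcess ℱ) (T : ℝ≥0) : ItoSimpleProcess ℱ where
  n := φ.n
  time i := min (φ.time i) T
  time_mono := fun _ _ h => min_le_min_right T (φ.time_mono h)
  coeff i ω := if φ.time i ≤ T then φ.coeff i ω else 0
  coeff_meas i := by
    by_cases h : φ.time i ≤ T
    · simp only [h, if_true]
      exact (φ.coeff_meas i).mono (ℱ.mono (le_min le_rfl h))
    · simp only [h, if_false]
      exact stronglyMeasurable_const
  coeff_bdd i := by
    obtain ⟨C, hC⟩ := φ.coeff_bdd i
    refine ⟨max C 0, fun ω => ?_⟩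
    split_ifs
    · exact (hC ω).trans (le_max_left _ _)
    · simp

lemma incr_restrict (φ : ItoSimpleProcess ℱ) (T : ℝ≥0) (w : ℝ≥0 → ℝ) (ω : Ω) :
    (φ.restrict T).incr w ω = φ.incr (fun x => w (min x T)) ω := by
  refine Finset.sum_congr rfl fun i _ => ?_
  simp only [restrict]
  split_ifs with h
  · rfl
  · have h' := (not_le.1 h).le
    rw [min_eq_right h', min_eq_right (h'.trans (φ.time_mono (Nat.le_succ i)))]
    simp

end ItoSimpleProcess

/-- Enumeration of a finite set of times in increasing order, stationary after the last one. -/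
lemma exists_monotone_enumeration {S : Finset ℝ≥0} (hS : S.Nonempty) :
    ∃ (u : ℕ → ℝ≥0) (N : ℕ), Monotone u ∧ StrictMonoOn u (Iic N) ∧ ∀ x ∈ S, ∃ i ≤ N, u i = x := by
  have hpos : 0 < S.card := hS.card_pos
  let e := S.orderEmbOfFin rfl
  refine ⟨fun k => e ⟨min k (S.card - 1), by omega⟩, S.card - 1, ?_, ?_, ?_⟩
  · intro i j hij
    refine e.monotone ?_
    rw [Fin.mk_le_mk]
    omega
  · intro i hi j hj hij
    refine e.strictMono ?_
    rw [mem_Iic] at hi hj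
    rw [Fin.mk_lt_mk]
    omega
  · intro x hx
    have : x ∈ range e := by
      rw [Finset.range_orderEmbOfFin]
      exact hx
    obtain ⟨i, hi⟩ := this
    have hi' := i.2
    refine ⟨(i : ℕ), by omega, ?_⟩
    rw [← hi]
    exact congrArg e (Fin.ext (min_eq_left (Nat.le_sub_one_of_lt hi')))

open Classical in
/-- The increments of `w` over the intervals of a partition inside `(u i, u j]` telescope. -/
lemma sum_refined_increments {u : ℕ → ℝ≥0} {N i j : ℕ} (hu : StrictMonoOn u (Iic N)) (hi : i ≤ N)
    (hj : j ≤ N) (hij : u i ≤ u j) (w : ℝ≥0 → ℝ) :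
    ∑ k ∈ Finset.range N, (if u i ≤ u k ∧ u (k + 1) ≤ u j then w (u (k + 1)) - w (u k) else 0) =
      w (u j) - w (u i) := by
  have hij' : i ≤ j := (hu.le_iff_le hi hj).1 hij
  rw [← Finset.sum_filter, ← Finset.sum_Ico_sub (fun k => w (u k)) hij']
  refine Finset.sum_congr ?_ fun _ _ => rfl
  ext k
  simp only [Finset.mem_filter, Finset.mem_range, Finset.mem_Ico]
  constructor
  · rintro ⟨hk, h1, h2⟩
    exact ⟨(hu.le_iff_le hi (mem_Iic.2 hk.le)).1 h1, (hu.le_iff_le (mem_Iic.2 hk) hj).1 h2⟩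
  · rintro ⟨h1, h2⟩
    exact ⟨by omega, (hu.le_iff_le hi (mem_Iic.2 (by omega))).2 h1,
      (hu.le_iff_le (mem_Iic.2 (by omega)) hj).2 h2⟩

namespace ItoSimpleProcess

variable {ℱ : Filtration ℝ≥0 mΩ}

open Classical in
/-- The coefficient of a simple process on the interval `(u k, u (k + 1)]` of a finer partition. -/
noncomputable def refinedCoeff (φ : ItoSimpleProcess ℱ) (u : ℕ → ℝ≥0) (k : ℕ) (ω : Ω) : ℝ :=
  ∑ i ∈ Finset.range φ.n,
    if φ.time i ≤ u k ∧ u (k + 1) ≤ φ.time (i + 1) then φ.coeff i ω else 0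

lemma stronglyMeasurable_refinedCoeff (φ : ItoSimpleProcess ℱ) (u : ℕ → ℝ≥0) (k : ℕ) :
    StronglyMeasurable[ℱ (u k)] (φ.refinedCoeff u k) := by
  refine Finset.stronglyMeasurable_fun_sum _ fun i _ => ?_
  by_cases h : φ.time i ≤ u k ∧ u (k + 1) ≤ φ.time (i + 1)
  · simp only [h, and_self, if_true]
    exact (φ.coeff_meas i).mono (ℱ.mono h.1)
  · simp only [h, if_false]
    exact stronglyMeasurable_const

lemma refinedCoeff_bdd (φ : ItoSimpleProcess ℱ) (u : ℕ → ℝ≥0) (k : ℕ) :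
    ∃ C : ℝ, ∀ ω, |φ.refinedCoeff u k ω| ≤ C := by
  choose C hC using φ.coeff_bdd
  refine ⟨∑ i ∈ Finset.range φ.n, |C i|, fun ω => (Finset.abs_sum_le_sum_abs _ _).trans
    (Finset.sum_le_sum fun i _ => ?_)⟩
  split_ifs
  · exact (hC i ω).trans (le_abs_self _)
  · simp

lemma sum_refinedCoeff (φ : ItoSimpleProcess ℱ) {u : ℕ → ℝ≥0} {N : ℕ}
    (hu : StrictMonoOn u (Iic N)) (hφ : ∀ i ≤ φ.n, ∃ k ≤ N, u k = φ.time i) (w : ℝ≥0 → ℝ) (ω : Ω) :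
    ∑ k ∈ Finset.range N, φ.refinedCoeff u k ω * (w (u (k + 1)) - w (u k)) = φ.incr w ω := by
  simp only [refinedCoeff, Finset.sum_mul]
  rw [Finset.sum_comm]
  refine Finset.sum_congr rfl fun i hi => ?_
  have hi := Finset.mem_range.1 hi
  obtain ⟨a, ha, hau⟩ := hφ i hi.le
  obtain ⟨b, hb, hbu⟩ := hφ (i + 1) hi
  have := sum_refined_increments hu ha hb
    (by rw [hau, hbu]; exact φ.time_mono (Nat.le_succ i)) w
  rw [← hau, ← hbu, ← this, Finset.mul_sum]
  refine Finset.sum_congr rfl fun k _ => ?_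
  split_ifs <;> simp

/-- Simple processes are closed under addition: pass to a common refinement of the partitions. -/
lemma exists_add (φ ψ : ItoSimpleProcess ℱ) :
    ∃ χ : ItoSimpleProcess ℱ, ∀ (w : ℝ≥0 → ℝ) (ω : Ω), χ.incr w ω = φ.incr w ω + ψ.incr w ω := by
  obtain ⟨u, N, hmono, hu, hS⟩ := exists_monotone_enumeration
    (S := (Finset.range (φ.n + 1)).image φ.time ∪ (Finset.range (ψ.n + 1)).image ψ.time)
    ⟨φ.time 0, Finset.mem_union_left _ (Finset.mem_image_of_mem _ (by simp))⟩
  have hφ : ∀ i ≤ φ.n, ∃ k ≤ N, u k = φ.time i := fun i hi => hS _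
    (Finset.mem_union_left _ (Finset.mem_image_of_mem _ (Finset.mem_range.2 (by omega))))
  have hψ : ∀ i ≤ ψ.n, ∃ k ≤ N, u k = ψ.time i := fun i hi => hS _
    (Finset.mem_union_right _ (Finset.mem_image_of_mem _ (Finset.mem_range.2 (by omega))))
  refine ⟨⟨N, u, hmono, fun k ω => φ.refinedCoeff u k ω + ψ.refinedCoeff u k ω,
    fun k => (φ.stronglyMeasurable_refinedCoeff u k).add (ψ.stronglyMeasurable_refinedCoeff u k),
    fun k => ?_⟩, fun w ω => ?_⟩
  · obtain ⟨C, hC⟩ := φ.refinedCoeff_bdd u k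
    obtain ⟨D, hD⟩ := ψ.refinedCoeff_bdd u k
    exact ⟨C + D, fun ω => (abs_add_le _ _).trans (add_le_add (hC ω) (hD ω))⟩
  · rw [← φ.sum_refinedCoeff hu hφ, ← ψ.sum_refinedCoeff hu hψ, ← Finset.sum_add_distrib]
    simp only [incr, add_mul]

end ItoSimpleProcess

/-! ### The Itô isometry for simple processes -/

section isometry
variable {μ : Measure Ω} {ℱ : Filtration ℝ≥0 mΩ} {W : ℝ≥0 → Ω → ℝ}

lemma IsFiltrationBrownian.memLp_sub (hW : IsFiltrationBrownian μ ℱ W) (s t : ℝ≥0) :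
    MemLp (fun ω => W t ω - W s ω) 2 μ :=
  ((hW.brownian.isGaussianProcess.hasGaussianLaw_eval t).memLp_two).sub
    ((hW.brownian.isGaussianProcess.hasGaussianLaw_eval s).memLp_two)

lemma IsFiltrationBrownian.integral_sub (hW : IsFiltrationBrownian μ ℱ W) (s t : ℝ≥0) :
    ∫ ω, W t ω - W s ω ∂μ = 0 := by
  have := (hW.brownian.hasLaw_sub t s).integral_eq
  rwa [integral_id_gaussianReal] at this

lemma IsFiltrationBrownian.integral_sub_sq (hW : IsFiltrationBrownian μ ℱ W) {s t : ℝ≥0}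
    (hst : s ≤ t) : ∫ ω, (W t ω - W s ω) ^ 2 ∂μ = t - s := by
  have h := (hW.brownian.hasLaw_sub t s).variance_eq
  rw [variance_id_gaussianReal, variance_of_integral_eq_zero
    (hW.brownian.hasLaw_sub t s).aemeasurable (hW.integral_sub s t)] at h
  simp only [Pi.sub_apply] at h
  rw [h, coe_nndist, Real.dist_eq]
  exact abs_of_nonneg (sub_nonneg.2 (NNReal.coe_le_coe.2 hst))

lemma IsFiltrationBrownian.indepFun_sub (hW : IsFiltrationBrownian μ ℱ W) {s t : ℝ≥0}
    (hst : s ≤ t) {X : Ω → ℝ} (hX : StronglyMeasurable[ℱ s] X) :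
    IndepFun X (fun ω => W t ω - W s ω) μ :=
  (indep_of_indep_of_le_right (hW.indep s t hst) hX.measurable.comap_le).symm

lemma memLp_two_bdd_mul {c X : Ω → ℝ} {C : ℝ} (hc : AEStronglyMeasurable c μ)
    (hC : ∀ ω, |c ω| ≤ C) (hX : MemLp X 2 μ) : MemLp (fun ω => c ω * X ω) 2 μ :=
  MemLp.of_le_mul (c := C) hX (hc.mul hX.1) (ae_of_all _ fun ω => by
    rw [norm_mul]; exact mul_le_mul_of_nonneg_right (hC ω) (norm_nonneg _))

/-- The Itô isometry for simple integrands. -/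
lemma IsFiltrationBrownian.ito_isometry [IsProbabilityMeasure μ] (hW : IsFiltrationBrownian μ ℱ W)
    {u : ℕ → ℝ≥0}
    (hu : Monotone u) {c : ℕ → Ω → ℝ} (hc : ∀ i, StronglyMeasurable[ℱ (u i)] (c i))
    (hcb : ∀ i, ∃ C : ℝ, ∀ ω, |c i ω| ≤ C) (n : ℕ) :
    StronglyMeasurable[ℱ (u n)]
        (fun ω => ∑ i ∈ Finset.range n, c i ω * (W (u (i + 1)) ω - W (u i) ω)) ∧
      MemLp (fun ω => ∑ i ∈ Finset.range n, c i ω * (W (u (i + 1)) ω - W (u i) ω)) 2 μ ∧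
      ∫ ω, (∑ i ∈ Finset.range n, c i ω * (W (u (i + 1)) ω - W (u i) ω)) ^ 2 ∂μ =
        ∫ ω, ∑ i ∈ Finset.range n, c i ω ^ 2 * ((u (i + 1) : ℝ) - u i) ∂μ := by
  induction n with
  | zero => simpa using stronglyMeasurable_const
  | succ n ih =>
    obtain ⟨h1, h2, h3⟩ := ih
    have hn : u n ≤ u (n + 1) := hu (Nat.le_succ n)
    obtain ⟨C, hC⟩ := hcb n
    have hcn : AEStronglyMeasurable (c n) μ := ((hc n).mono (ℱ.le _)).aestronglyMeasurable
    have hterm : MemLp (fun ω => c n ω * (W (u (n + 1)) ω - W (u n) ω)) 2 μ :=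
      memLp_two_bdd_mul hcn hC (hW.memLp_sub _ _)
    set M : Ω → ℝ := fun ω => ∑ i ∈ Finset.range n, c i ω * (W (u (i + 1)) ω - W (u i) ω) with hM
    have hc2 : ∀ i, Integrable (fun ω => c i ω ^ 2) μ := fun i => by
      obtain ⟨D, hD⟩ := hcb i
      refine (MemLp.of_bound ((hc i).mono (ℱ.le _)).aestronglyMeasurable D
        (ae_of_all _ fun ω => hD ω) : MemLp (c i) 2 μ).integrable_sq
    simp only [Finset.sum_range_succ]
    refine ⟨(h1.mono (ℱ.mono hn)).add (((hc n).mono (ℱ.mono hn)).mul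
      ((hW.adapted _).sub ((hW.adapted _).mono (ℱ.mono hn)))), h2.add hterm, ?_⟩
    have hcross_int : Integrable (fun ω => c n ω * M ω) μ :=
      (memLp_two_bdd_mul hcn hC h2).integrable (by norm_num)
    have hcross_meas : StronglyMeasurable[ℱ (u n)] fun ω => c n ω * M ω := (hc n).mul h1
    -- the increment is centred and independent of `c n * M`: the cross term vanishes
    have hind := hW.indepFun_sub hn hcross_meas
    have hDint := (hW.memLp_sub (u n) (u (n + 1))).integrable (by norm_num)
    have hcross : ∫ ω, (c n ω * M ω) * (W (u (n + 1)) ω - W (u n) ω) ∂μ = 0 := by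
      rw [hind.integral_fun_mul_eq_mul_integral hcross_int.1 hDint.1, hW.integral_sub, mul_zero]
    have hsq_ind : IndepFun (fun ω => c n ω ^ 2) (fun ω => (W (u (n + 1)) ω - W (u n) ω) ^ 2) μ :=
      (hW.indepFun_sub hn (hc n)).comp (φ := fun x : ℝ => x ^ 2) (ψ := fun x : ℝ => x ^ 2)
        (by fun_prop) (by fun_prop)
    have hD2 := (hW.memLp_sub (u n) (u (n + 1))).integrable_sq
    have hsq : ∫ ω, c n ω ^ 2 * (W (u (n + 1)) ω - W (u n) ω) ^ 2 ∂μ =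
        ∫ ω, c n ω ^ 2 * ((u (n + 1) : ℝ) - u n) ∂μ := by
      rw [hsq_ind.integral_fun_mul_eq_mul_integral (hc2 n).1 hD2.1, hW.integral_sub_sq hn,
        integral_mul_const]
    have hexp : ∀ ω, (M ω + c n ω * (W (u (n + 1)) ω - W (u n) ω)) ^ 2 =
        M ω ^ 2 + 2 * ((c n ω * M ω) * (W (u (n + 1)) ω - W (u n) ω)) +
          c n ω ^ 2 * (W (u (n + 1)) ω - W (u n) ω) ^ 2 := fun ω => by ring
    have hi1 : Integrable (fun ω => 2 * ((c n ω * M ω) * (W (u (n + 1)) ω - W (u n) ω))) μ :=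
      (hind.integrable_mul hcross_int hDint).const_mul 2
    have hi2 : Integrable (fun ω => c n ω ^ 2 * (W (u (n + 1)) ω - W (u n) ω) ^ 2) μ :=
      hsq_ind.integrable_mul (hc2 n) hD2
    change ∫ ω, (M ω + c n ω * (W (u (n + 1)) ω - W (u n) ω)) ^ 2 ∂μ = _
    simp only [hexp]
    have hi3 : Integrable (fun ω => M ω ^ 2 +
      2 * ((c n ω * M ω) * (W (u (n + 1)) ω - W (u n) ω))) μ := h2.integrable_sq.add hi1
    have h3' : ∫ ω, M ω ^ 2 ∂μ = _ := h3
    rw [integral_add hi3 hi2, integral_add h2.integrable_sq hi1,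
      integral_const_mul, hcross, hsq, mul_zero, add_zero, h3', ← integral_add]
    · exact integrable_finsetSum _ fun i _ => (hc2 i).mul_const _
    · exact (hc2 n).mul_const _

/-- A simple integral is small in probability as soon as its quadratic variation is: truncate the
integrand when the quadratic variation exceeds `δ`, and apply the isometry to the truncation. -/
lemma IsFiltrationBrownian.measure_sum_ge_le [IsProbabilityMeasure μ]
    (hW : IsFiltrationBrownian μ ℱ W) {u : ℕ → ℝ≥0}
    (hu : Monotone u) {c : ℕ → Ω → ℝ} (hc : ∀ i, StronglyMeasurable[ℱ (u i)] (c i))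
    (hcb : ∀ i, ∃ C : ℝ, ∀ ω, |c i ω| ≤ C) (n : ℕ) {δ η : ℝ} (hδ : 0 ≤ δ) (hη : 0 < η) :
    μ {ω | η ≤ |∑ i ∈ Finset.range n, c i ω * (W (u (i + 1)) ω - W (u i) ω)|} ≤
      μ {ω | δ < ∑ i ∈ Finset.range n, c i ω ^ 2 * ((u (i + 1) : ℝ) - u i)} +
        ENNReal.ofReal (δ / η ^ 2) := by
  let S : ℕ → Ω → ℝ := fun m ω => ∑ i ∈ Finset.range m, c i ω ^ 2 * ((u (i + 1) : ℝ) - u i)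
  have hterm : ∀ i ω, 0 ≤ c i ω ^ 2 * ((u (i + 1) : ℝ) - u i) := fun i ω =>
    mul_nonneg (sq_nonneg _) (sub_nonneg.2 (NNReal.coe_le_coe.2 (hu (Nat.le_succ i))))
  have hSmono : ∀ ω, Monotone fun m => S m ω := fun ω => monotone_nat_of_le_succ fun m => by
    simp only [S, Finset.sum_range_succ]
    exact le_add_of_nonneg_right (hterm m ω)
  have hSmeas : ∀ m, Measurable[ℱ (u m)] (S (m + 1)) := fun m =>
    (Finset.stronglyMeasurable_fun_sum _ fun i hi => (((hc i).mono (ℱ.mono (hu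
      (Nat.lt_succ_iff.1 (Finset.mem_range.1 hi))))).pow 2).mul_const _).measurable
  -- `d i` is known at time `u i`, as the quadratic variation up to `u (i + 1)` uses `c j`, `j ≤ i`
  let d : ℕ → Ω → ℝ := fun i => {ω | S (i + 1) ω ≤ δ}.indicator (c i)
  have hd : ∀ i, StronglyMeasurable[ℱ (u i)] (d i) := fun i =>
    (hc i).indicator (measurableSet_le (hSmeas i) measurable_const)
  have hdb : ∀ i, ∃ C : ℝ, ∀ ω, |d i ω| ≤ C := fun i => by
    obtain ⟨C, hC⟩ := hcb i
    exact ⟨C, fun ω => (norm_indicator_le_norm_self (c i) ω).trans (hC ω)⟩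
  have hQ : ∀ m ω, ∑ i ∈ Finset.range m, d i ω ^ 2 * ((u (i + 1) : ℝ) - u i) ≤ δ := by
    intro m ω
    induction m with
    | zero => simpa using hδ
    | succ m ih =>
      by_cases h : S (m + 1) ω ≤ δ
      · refine le_trans (Finset.sum_le_sum fun i _ => ?_) h
        by_cases hi : S (i + 1) ω ≤ δ
        · simp [d, hi]
        · simpa [d, hi] using hterm i ω
      · rw [Finset.sum_range_succ]
        simpa [d, h] using ih
  obtain ⟨-, hL2, hiso⟩ := hW.ito_isometry hu hd hdb n
  set M : Ω → ℝ := fun ω => ∑ i ∈ Finset.range n, d i ω * (W (u (i + 1)) ω - W (u i) ω) with hM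
  have hMle : ∫ ω, M ω ^ 2 ∂μ ≤ δ := by
    refine hiso.le.trans ((integral_mono_of_nonneg (ae_of_all _ fun ω => ?_)
      (integrable_const δ) (ae_of_all _ fun ω => hQ n ω)).trans (by simp))
    exact Finset.sum_nonneg fun i _ => mul_nonneg (sq_nonneg _)
      (sub_nonneg.2 (NNReal.coe_le_coe.2 (hu (Nat.le_succ i))))
  have hcheb : μ {ω | η ≤ |M ω|} ≤ ENNReal.ofReal (δ / η ^ 2) := by
    have := mul_meas_ge_le_integral_of_nonneg (ae_of_all _ fun ω => sq_nonneg (M ω))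
      hL2.integrable_sq (η ^ 2)
    rw [← ofReal_measureReal]
    refine ENNReal.ofReal_le_ofReal ?_
    rw [le_div_iff₀ (by positivity), mul_comm]
    have hset : {ω | η ≤ |M ω|} = {ω | η ^ 2 ≤ M ω ^ 2} := by
      ext ω
      simp only [mem_ofPred_eq]
      rw [sq_le_sq, abs_of_pos hη]
    rw [hset]
    exact this.trans hMle
  refine (measure_mono (t := {ω | δ < S n ω} ∪ {ω | η ≤ |M ω|}) fun ω hω => ?_).trans
    ((measure_union_le _ _).trans (add_le_add le_rfl hcheb))
  by_cases h : δ < S n ω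
  · exact Or.inl h
  · refine Or.inr ?_
    have heq : M ω = ∑ i ∈ Finset.range n, c i ω * (W (u (i + 1)) ω - W (u i) ω) := by
      refine Finset.sum_congr rfl fun i hi => ?_
      have : S (i + 1) ω ≤ δ := (hSmono ω (Finset.mem_range.1 hi)).trans (not_lt.1 h)
      simp [d, this]
    simp only [mem_ofPred_eq] at hω ⊢
    rwa [heq]

end isometry
end

/-! ### Approximation in probability and uniqueness of the Itô integral -/

section
variable {Ω : Type*} {mΩ : MeasurableSpace Ω} {μ : Measure Ω} {ℱ : Filtration ℝ≥0 mΩ}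
  {W Y Z : ℝ≥0 → Ω → ℝ} {t : ℝ≥0} {J J' : Ω → ℝ}

/-- `J` is approximated in probability by elementary integrals of simple processes that approximate
`Y` in `L²[0, t]` in probability, in the `ε`-form: no measurability or integrability of `Y` is
required. -/
def HasItoApprox (μ : Measure Ω) (ℱ : Filtration ℝ≥0 mΩ) (W Y : ℝ≥0 → Ω → ℝ) (t : ℝ≥0)
    (J : Ω → ℝ) : Prop :=
  ∀ η : ℝ, 0 < η → ∃ φ : ItoSimpleProcess ℱ,
    μ {ω | ENNReal.ofReal η ≤ ∫⁻ s in Icc (0 : ℝ) t,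
      ENNReal.ofReal ((φ.val s.toNNReal ω - Y s.toNNReal ω) ^ 2)} ≤ ENNReal.ofReal η ∧
    μ {ω | η ≤ |φ.integral W t ω - J ω|} ≤ ENNReal.ofReal η

lemma IsItoIntegral.hasItoApprox (h : IsItoIntegral μ ℱ W Y t J) : HasItoApprox μ ℱ W Y t J := by
  obtain ⟨-, -, φ, h1, h2⟩ := h
  intro η hη
  have hη' : 0 < ENNReal.ofReal η := ENNReal.ofReal_pos.2 hη
  have e1 := (h1 _ hη').eventually (eventually_le_nhds hη')
  rw [tendstoInMeasure_iff_dist] at h2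
  have e2 := (h2 η hη).eventually (eventually_le_nhds hη')
  obtain ⟨n, hn1, hn2⟩ := (e1.and e2).exists
  exact ⟨φ n, hn1, hn2⟩

lemma HasItoApprox.isItoIntegral (h : HasItoApprox μ ℱ W Y t J) (hY : IsStronglyProgressive ℱ Y)
    (hfin : ∀ᵐ ω ∂μ, ∫⁻ s in Icc (0 : ℝ) t, ENNReal.ofReal (Y s.toNNReal ω ^ 2) < ∞) :
    IsItoIntegral μ ℱ W Y t J := by
  choose φ h1 h2 using fun n : ℕ => h (1 / ((n : ℝ) + 1)) Nat.one_div_pos_of_nat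
  have hlim : Tendsto (fun n : ℕ => ENNReal.ofReal (1 / ((n : ℝ) + 1))) atTop (𝓝 0) := by
    simpa [Function.comp_def] using (ENNReal.continuous_ofReal.tendsto 0).comp
      (tendsto_one_div_add_atTop_nhds_zero_nat (𝕜 := ℝ))
  refine ⟨hY, hfin, φ, fun δ hδ => ?_, ?_⟩
  · refine tendsto_of_tendsto_of_tendsto_of_le_of_le' tendsto_const_nhds hlim
      (Eventually.of_forall fun _ => zero_le) ?_
    filter_upwards [hlim.eventually (eventually_le_nhds hδ)] with n hn
    exact (measure_mono fun ω hω => hn.trans hω).trans (h1 n)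
  · rw [tendstoInMeasure_iff_dist]
    intro δ hδ
    refine tendsto_of_tendsto_of_tendsto_of_le_of_le' tendsto_const_nhds hlim
      (Eventually.of_forall fun _ => zero_le) ?_
    filter_upwards [(tendsto_one_div_add_atTop_nhds_zero_nat (𝕜 := ℝ)).eventually
      (eventually_le_nhds hδ)] with n hn
    exact (measure_mono fun ω hω => hn.trans hω).trans (h2 n)

lemma HasItoApprox.congr_ae (h : HasItoApprox μ ℱ W Y t J) (hJ : J =ᵐ[μ] J') :
    HasItoApprox μ ℱ W Y t J' := by
  intro η hη
  obtain ⟨φ, h1, h2⟩ := h η hη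
  refine ⟨φ, h1, (measure_mono_ae ?_).trans h2⟩
  filter_upwards [hJ] with ω hω hmem
  change η ≤ |φ.integral W t ω - J ω|
  rw [hω]
  exact hmem

/-- Only one of the two functions needs to be measurable. -/
lemma lintegral_add_sq_le {α : Type*} {mα : MeasurableSpace α} {ν : Measure α} {f g : α → ℝ}
    (hf : AEMeasurable f ν) :
    ∫⁻ s, ENNReal.ofReal ((f s + g s) ^ 2) ∂ν ≤
      2 * (∫⁻ s, ENNReal.ofReal (f s ^ 2) ∂ν) + 2 * ∫⁻ s, ENNReal.ofReal (g s ^ 2) ∂ν := by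
  have h2 : (2 : ℝ≥0∞) = ENNReal.ofReal 2 := by simp
  rw [← lintegral_const_mul' _ _ (by simp), ← lintegral_const_mul' _ _ (by simp),
    ← lintegral_add_left' ((hf.pow_const 2).ennreal_ofReal.const_mul 2)]
  refine lintegral_mono fun s => ?_
  simp only [h2]
  rw [← ENNReal.ofReal_mul (by norm_num), ← ENNReal.ofReal_mul (by norm_num),
    ← ENNReal.ofReal_add (by positivity) (by positivity)]
  exact ENNReal.ofReal_le_ofReal (by nlinarith [sq_nonneg (f s - g s)])

lemma ItoSimpleProcess.measurable_val (φ : ItoSimpleProcess ℱ) (ω : Ω) :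
    Measurable fun s : ℝ => φ.val s.toNNReal ω := by
  have : Measurable fun s : ℝ≥0 => φ.val s ω :=
    Finset.measurable_fun_sum _ fun i _ => measurable_const.indicator measurableSet_Ioc
  exact this.comp measurable_real_toNNReal

/-- If `c ≤ 2 a + 2 b`, as for the squared distances in `lintegral_add_sq_le`, then `c` can
reach `η` only if `a` or `b` reaches `η / 8`. -/
lemma ofReal_le_imp_of_le_two_mul_add {a b c : ℝ≥0∞} {η : ℝ} (hη : 0 < η)
    (h : c ≤ 2 * a + 2 * b) (hc : ENNReal.ofReal η ≤ c) :
    ENNReal.ofReal (η / 8) ≤ a ∨ ENNReal.ofReal (η / 8) ≤ b := by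
  by_contra! hcon
  have h2 : (2 : ℝ≥0∞) = ENNReal.ofReal 2 := by simp
  have : c < ENNReal.ofReal η := by
    calc c ≤ 2 * a + 2 * b := h
      _ ≤ 2 * ENNReal.ofReal (η / 8) + 2 * ENNReal.ofReal (η / 8) :=
        add_le_add (mul_le_mul_right hcon.1.le 2) (mul_le_mul_right hcon.2.le 2)
      _ = ENNReal.ofReal (η / 2) := by
        rw [h2, ← ENNReal.ofReal_mul (by norm_num), ← ENNReal.ofReal_add (by positivity)
          (by positivity)]
        congr 1; ring
      _ < ENNReal.ofReal η := (ENNReal.ofReal_lt_ofReal_iff hη).2 (by linarith)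
  exact absurd hc (not_le.2 this)

lemma measure_le_of_subset_union {A B C : Set Ω} {η : ℝ} (hη : 0 < η) (hC : C ⊆ A ∪ B)
    (hA : μ A ≤ ENNReal.ofReal (η / 8)) (hB : μ B ≤ ENNReal.ofReal (η / 8)) :
    μ C ≤ ENNReal.ofReal η := by
  refine (measure_mono hC).trans ((measure_union_le _ _).trans ((add_le_add hA hB).trans ?_))
  rw [← ENNReal.ofReal_add (by positivity) (by positivity)]
  exact ENNReal.ofReal_le_ofReal (by linarith)

lemma HasItoApprox.zero : HasItoApprox μ ℱ W (fun _ _ => 0) t (fun _ => 0) := by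
  intro η hη
  refine ⟨⟨0, fun _ => 0, monotone_const, fun _ _ => 0, fun _ => stronglyMeasurable_const,
    fun _ => ⟨0, by simp⟩⟩, ?_, ?_⟩
  · simp [ItoSimpleProcess.val, not_le.2 hη]
  · simp [ItoSimpleProcess.integral, not_le.2 hη]

lemma HasItoApprox.add (hY : HasItoApprox μ ℱ W Y t J) (hZ : HasItoApprox μ ℱ W Z t J')
    (hm : ∀ ω, AEMeasurable (fun s : ℝ => Y s.toNNReal ω) (volume.restrict (Icc (0 : ℝ) t))) :
    HasItoApprox μ ℱ W (fun s ω => Y s ω + Z s ω) t (fun ω => J ω + J' ω) := by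
  intro η hη
  obtain ⟨φ, h1, h2⟩ := hY (η / 8) (by positivity)
  obtain ⟨ψ, h3, h4⟩ := hZ (η / 8) (by positivity)
  obtain ⟨χ, hχ⟩ := φ.exists_add ψ
  refine ⟨χ, measure_le_of_subset_union hη (fun ω hω => ?_) h1 h3,
    measure_le_of_subset_union hη (fun ω hω => ?_) h2 h4⟩
  · refine ofReal_le_imp_of_le_two_mul_add hη ?_ hω
    refine le_trans (lintegral_mono fun s => ?_)
      (lintegral_add_sq_le ((φ.measurable_val ω).aemeasurable.sub (hm ω)))
    rw [χ.val_eq_incr, hχ, ← φ.val_eq_incr, ← ψ.val_eq_incr]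
    exact le_of_eq (by congr 2; beta_reduce; ring)
  · by_contra hcon
    simp only [mem_union, mem_ofPred_eq, not_or, not_le] at hcon hω
    rw [χ.integral_eq_incr, hχ, ← φ.integral_eq_incr, ← ψ.integral_eq_incr] at hω
    have := abs_add_le (φ.integral W t ω - J ω) (ψ.integral W t ω - J' ω)
    rw [show φ.integral W t ω + ψ.integral W t ω - (J ω + J' ω) =
      (φ.integral W t ω - J ω) + (ψ.integral W t ω - J' ω) by ring] at hω
    linarith [hcon.1, hcon.2]

lemma HasItoApprox.const_mul (hY : HasItoApprox μ ℱ W Y t J) (a : ℝ) :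
    HasItoApprox μ ℱ W (fun s ω => a * Y s ω) t (fun ω => a * J ω) := by
  intro η hη
  -- the tolerance `ρ` satisfies `ρ ≤ η`, `a² ρ < η` and `|a| ρ < η`
  obtain ⟨ρ, hρ⟩ : ∃ ρ, ρ = η / (1 + a ^ 2 + |a|) := ⟨_, rfl⟩
  have hden : 0 < 1 + a ^ 2 + |a| := by positivity
  have hρ0 : 0 < ρ := by rw [hρ]; positivity
  have hρη : ρ + a ^ 2 * ρ + |a| * ρ = η := by
    rw [hρ]; field_simp
  have ha2 : 0 ≤ a ^ 2 * ρ := by positivity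
  have ha1 : 0 ≤ |a| * ρ := by positivity
  obtain ⟨φ, h1, h2⟩ := hY ρ hρ0
  refine ⟨φ.smul a, (measure_mono fun ω hω => ?_).trans
    (h1.trans (ENNReal.ofReal_le_ofReal (by linarith))),
    (measure_mono fun ω hω => ?_).trans (h2.trans (ENNReal.ofReal_le_ofReal (by linarith)))⟩
  · by_contra hcon
    simp only [mem_ofPred_eq, not_le] at hcon hω
    have heq : ∀ s : ℝ, ENNReal.ofReal (((φ.smul a).val s.toNNReal ω - a * Y s.toNNReal ω) ^ 2) =
        ENNReal.ofReal (a ^ 2) * ENNReal.ofReal ((φ.val s.toNNReal ω - Y s.toNNReal ω) ^ 2) := by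
      intro s
      rw [← ENNReal.ofReal_mul (sq_nonneg a), ItoSimpleProcess.val_eq_incr,
        ItoSimpleProcess.incr_smul, ← ItoSimpleProcess.val_eq_incr]
      congr 1; ring
    simp only [heq] at hω
    rw [lintegral_const_mul' _ _ (by simp)] at hω
    have := hω.trans (mul_le_mul_right hcon.le _)
    rw [← ENNReal.ofReal_mul (sq_nonneg a), ENNReal.ofReal_le_ofReal_iff (by positivity)] at this
    linarith
  · by_contra hcon
    simp only [mem_ofPred_eq, not_le] at hcon hω
    rw [ItoSimpleProcess.integral_eq_incr, ItoSimpleProcess.incr_smul,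
      ← ItoSimpleProcess.integral_eq_incr, ← mul_sub, abs_mul] at hω
    have := mul_le_mul_of_nonneg_left hcon.le (abs_nonneg a)
    linarith

lemma HasItoApprox.sum {N : ℕ} {X : ℕ → ℝ≥0 → Ω → ℝ} {I : ℕ → Ω → ℝ}
    (hX : ∀ i < N, HasItoApprox μ ℱ W (X i) t (I i))
    (hm : ∀ i ω, AEMeasurable (fun s : ℝ => X i s.toNNReal ω)
      (volume.restrict (Icc (0 : ℝ) t))) :
    HasItoApprox μ ℱ W (fun s ω => ∑ i ∈ Finset.range N, X i s ω) t
      (fun ω => ∑ i ∈ Finset.range N, I i ω) := by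
  induction N with
  | zero => simpa using HasItoApprox.zero
  | succ N ih =>
    simp only [Finset.sum_range_succ]
    exact (ih fun i hi => hX i (by omega)).add (hX N (by omega))
      fun ω => Finset.aemeasurable_fun_sum _ fun i _ => hm i ω

/-- An Itô integral up to time `T` is an Itô integral up to a later time of the integrand cut off
at `T`. -/
lemma HasItoApprox.cutoff {T : ℝ≥0} (hY : HasItoApprox μ ℱ W Y T J) (hT : T ≤ t) :
    HasItoApprox μ ℱ W (fun s ω => if s ≤ T then Y s ω else 0) t J := by
  intro η hη
  obtain ⟨φ, h1, h2⟩ := hY η hη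
  refine ⟨φ.restrict T, le_trans (measure_mono fun ω hω => ?_) h1,
    le_trans (measure_mono fun ω hω => ?_) h2⟩
  · rw [mem_ofPred_eq] at hω
    refine hω.trans (le_of_eq ?_)
    beta_reduce
    have : ∀ s ∈ Icc (0 : ℝ) t, ENNReal.ofReal (((φ.restrict T).val s.toNNReal ω -
        if s.toNNReal ≤ T then Y s.toNNReal ω else 0) ^ 2) = (Icc (0 : ℝ) T).indicator (fun s =>
          ENNReal.ofReal ((φ.val s.toNNReal ω - Y s.toNNReal ω) ^ 2)) s := by
      intro s hs
      have hiff : s.toNNReal ≤ T ↔ s ≤ (T : ℝ) := by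
        rw [← NNReal.coe_le_coe, Real.coe_toNNReal s hs.1]
      rw [ItoSimpleProcess.val_eq_incr, ItoSimpleProcess.incr_restrict]
      by_cases h : s.toNNReal ≤ T
      · rw [if_pos h,
          indicator_of_mem (show s ∈ Icc (0 : ℝ) T from ⟨hs.1, hiff.1 h⟩),
          ItoSimpleProcess.val_eq_incr]
        simp only [le_min_iff, h, and_true]
      · rw [if_neg h, indicator_of_notMem fun h' => h (hiff.2 h'.2)]
        simp [h, ItoSimpleProcess.incr]
    rw [setLIntegral_congr_fun measurableSet_Icc this, setLIntegral_indicator measurableSet_Icc,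
      inter_eq_left.2 (Icc_subset_Icc_right (NNReal.coe_le_coe.2 hT))]
  · have : (φ.restrict T).integral W t ω = φ.integral W T ω := by
      rw [ItoSimpleProcess.integral_eq_incr, ItoSimpleProcess.incr_restrict]
      simp only [min_assoc, min_eq_left hT]
      rfl
    rw [mem_ofPred_eq, this] at hω
    exact hω

/-- Itô integrals are stable under limits in probability of integrands and integrals. -/
lemma HasItoApprox.of_tendsto {X : ℕ → ℝ≥0 → Ω → ℝ} {I : ℕ → Ω → ℝ}
    (hX : ∀ N, HasItoApprox μ ℱ W (X N) t (I N))
    (hm : ∀ N ω, AEMeasurable (fun s : ℝ => X N s.toNNReal ω) (volume.restrict (Icc (0 : ℝ) t)))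
    (hXY : ∀ δ : ℝ, 0 < δ → ∀ᶠ N in atTop, μ {ω | ENNReal.ofReal δ ≤ ∫⁻ s in Icc (0 : ℝ) t,
      ENNReal.ofReal ((X N s.toNNReal ω - Y s.toNNReal ω) ^ 2)} ≤ ENNReal.ofReal δ)
    (hIJ : ∀ δ : ℝ, 0 < δ → ∀ᶠ N in atTop, μ {ω | δ ≤ |I N ω - J ω|} ≤ ENNReal.ofReal δ) :
    HasItoApprox μ ℱ W Y t J := by
  intro η hη
  have h8 : 0 < η / 8 := by positivity
  obtain ⟨N, h1, h2⟩ := ((hXY _ h8).and (hIJ _ h8)).exists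
  obtain ⟨φ, h3, h4⟩ := hX N _ h8
  refine ⟨φ, measure_le_of_subset_union hη (fun ω hω => ?_) h3 h1,
    measure_le_of_subset_union hη (fun ω hω => ?_) h4 h2⟩
  · refine ofReal_le_imp_of_le_two_mul_add hη ?_ hω
    refine le_trans (lintegral_mono fun s => ?_)
      (lintegral_add_sq_le ((φ.measurable_val ω).aemeasurable.sub (hm N ω)))
    exact le_of_eq (by congr 2; ring)
  · by_contra hcon
    simp only [mem_union, mem_ofPred_eq, not_or, not_le] at hcon hω
    have := abs_sub_le (φ.integral W t ω) (I N ω) (J ω)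
    linarith [hcon.1, hcon.2]

/-- The intervals of a simple process are disjoint, so that squaring acts on the coefficients. -/
lemma ItoSimpleProcess.val_sq (φ : ItoSimpleProcess ℱ) (s : ℝ≥0) (ω : Ω) :
    φ.val s ω ^ 2 = ∑ i ∈ Finset.range φ.n,
      (Ioc (φ.time i) (φ.time (i + 1))).indicator (fun _ => φ.coeff i ω ^ 2) s := by
  by_cases h : ∃ k ∈ Finset.range φ.n, s ∈ Ioc (φ.time k) (φ.time (k + 1))
  · obtain ⟨k, hk, hs⟩ := h
    have hne : ∀ i, i ≠ k → s ∉ Ioc (φ.time i) (φ.time (i + 1)) := fun i hi hsi =>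
      disjoint_left.1 (φ.time_mono.pairwise_disjoint_on_Ioc_succ hi) hsi hs
    rw [val, Finset.sum_eq_single k (fun i _ hi => indicator_of_notMem (hne i hi) _)
      (fun h => absurd hk h), Finset.sum_eq_single k
      (fun i _ hi => indicator_of_notMem (hne i hi) _) (fun h => absurd hk h),
      indicator_of_mem hs, indicator_of_mem hs]
  · push Not at h
    rw [val, Finset.sum_eq_zero fun i hi => indicator_of_notMem (h i hi) _,
      Finset.sum_eq_zero fun i hi => indicator_of_notMem (h i hi) _]
    simp

lemma ItoSimpleProcess.lintegral_val_sq (φ : ItoSimpleProcess ℱ) (t : ℝ≥0) (ω : Ω) :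
    ∫⁻ s in Icc (0 : ℝ) t, ENNReal.ofReal (φ.val s.toNNReal ω ^ 2) =
      ENNReal.ofReal (∑ i ∈ Finset.range φ.n, (φ.restrict t).coeff i ω ^ 2 *
        (((φ.restrict t).time (i + 1) : ℝ) - (φ.restrict t).time i)) := by
  have hmono := (φ.restrict t).time_mono
  have hpt : ∀ s ∈ Icc (0 : ℝ) t, ENNReal.ofReal (φ.val s.toNNReal ω ^ 2) =
      ∑ i ∈ Finset.range φ.n, (Ioc (φ.time i : ℝ) (φ.time (i + 1))).indicator
        (fun _ => ENNReal.ofReal (φ.coeff i ω ^ 2)) s := by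
    intro s hs
    rw [φ.val_sq, ENNReal.ofReal_sum_of_nonneg
      fun i _ => indicator_nonneg (fun _ _ => sq_nonneg _) _]
    refine Finset.sum_congr rfl fun i _ => ?_
    have hiff : s.toNNReal ∈ Ioc (φ.time i) (φ.time (i + 1)) ↔
        s ∈ Ioc (φ.time i : ℝ) (φ.time (i + 1)) := by
      simp only [mem_Ioc, ← NNReal.coe_lt_coe, ← NNReal.coe_le_coe, Real.coe_toNNReal s hs.1]
    by_cases h : s ∈ Ioc (φ.time i : ℝ) (φ.time (i + 1))
    · rw [indicator_of_mem h, indicator_of_mem (hiff.2 h)]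
    · rw [indicator_of_notMem h, indicator_of_notMem fun h' => h (hiff.1 h'), ENNReal.ofReal_zero]
  rw [setLIntegral_congr_fun measurableSet_Icc hpt, lintegral_finsetSum _ fun i _ =>
    measurable_const.indicator measurableSet_Ioc, ENNReal.ofReal_sum_of_nonneg fun i _ =>
    mul_nonneg (sq_nonneg _) (sub_nonneg.2 (NNReal.coe_le_coe.2 (hmono (Nat.le_succ i))))]
  refine Finset.sum_congr rfl fun i _ => ?_
  rw [lintegral_indicator_const measurableSet_Ioc, Measure.restrict_apply measurableSet_Ioc,
    ENNReal.ofReal_mul (sq_nonneg _)]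
  have hset : Ioc (φ.time i : ℝ) (φ.time (i + 1)) ∩ Icc (0 : ℝ) t =
      Ioc (φ.time i : ℝ) (min (φ.time (i + 1)) t) := by
    ext s
    simp only [mem_inter_iff, mem_Ioc, mem_Icc, le_min_iff]
    exact ⟨fun h => ⟨h.1.1, h.1.2, h.2.2⟩, fun h => ⟨⟨h.1, h.2.1⟩,
      (φ.time i).coe_nonneg.trans h.1.le, h.2.2⟩⟩
  rw [hset, Real.volume_Ioc]
  simp only [restrict]
  by_cases h : φ.time i ≤ t
  · rw [if_pos h, min_eq_left h, NNReal.coe_min]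
  · have h' : (t : ℝ) ≤ φ.time i := NNReal.coe_le_coe.2 (not_le.1 h).le
    rw [if_neg h, ENNReal.ofReal_of_nonpos (sub_nonpos.2 ((min_le_right _ _).trans h'))]
    simp

/-- The elementary integral is controlled in probability by the `L²[0, t]` norm of the integrand. -/
lemma ItoSimpleProcess.measure_integral_ge_le [IsProbabilityMeasure μ]
    (hW : IsFiltrationBrownian μ ℱ W) (φ : ItoSimpleProcess ℱ) (t : ℝ≥0) {δ η : ℝ} (hδ : 0 ≤ δ)
    (hη : 0 < η) :
    μ {ω | η ≤ |φ.integral W t ω|} ≤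
      μ {ω | ENNReal.ofReal δ ≤ ∫⁻ s in Icc (0 : ℝ) t, ENNReal.ofReal (φ.val s.toNNReal ω ^ 2)} +
        ENNReal.ofReal (δ / η ^ 2) := by
  have h := hW.measure_sum_ge_le (φ.restrict t).time_mono (φ.restrict t).coeff_meas
    (φ.restrict t).coeff_bdd φ.n hδ hη
  have hint : ∀ ω, ∑ i ∈ Finset.range φ.n, (φ.restrict t).coeff i ω *
      (W ((φ.restrict t).time (i + 1)) ω - W ((φ.restrict t).time i) ω) = φ.integral W t ω :=
    fun ω => φ.incr_restrict t (fun x => W x ω) ω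
  simp only [hint] at h
  refine h.trans (add_le_add (measure_mono fun ω hω => ?_) le_rfl)
  rw [mem_ofPred_eq, φ.lintegral_val_sq]
  exact ENNReal.ofReal_le_ofReal (le_of_lt hω)

/-- Uniqueness of the Itô integral. -/
lemma HasItoApprox.ae_eq [IsProbabilityMeasure μ] (hW : IsFiltrationBrownian μ ℱ W)
    (hJ : HasItoApprox μ ℱ W Y t J) (hJ' : HasItoApprox μ ℱ W Y t J')
    (hm : ∀ ω, AEMeasurable (fun s : ℝ => Y s.toNNReal ω) (volume.restrict (Icc (0 : ℝ) t))) :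
    J =ᵐ[μ] J' := by
  -- it suffices that an integral of the zero integrand vanishes
  have hdiff : HasItoApprox μ ℱ W (fun _ _ => 0) t (fun ω => J ω - J' ω) := by
    have := hJ.add (hJ'.const_mul (-1)) hm
    simpa [← sub_eq_add_neg] using this
  have key : ∀ d : ℝ, 0 < d → μ {ω | d ≤ |J ω - J' ω|} = 0 := by
    intro d hd
    have hlim : Tendsto (fun η : ℝ => ENNReal.ofReal (η + (η + η / (d / 2) ^ 2))) (𝓝[>] 0)
        (𝓝 0) := by
      have : Continuous fun η : ℝ => ENNReal.ofReal (η + (η + η / (d / 2) ^ 2)) :=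
        ENNReal.continuous_ofReal.comp (by fun_prop)
      simpa using (this.tendsto 0).mono_left nhdsWithin_le_nhds
    refine le_antisymm (ge_of_tendsto hlim ?_) zero_le
    filter_upwards [Ioc_mem_nhdsGT (show (0 : ℝ) < d / 2 by positivity)] with η hη
    obtain ⟨φ, h1, h2⟩ := hdiff η hη.1
    simp only [sub_zero] at h1
    have h3 := φ.measure_integral_ge_le hW t (δ := η) (η := d / 2) hη.1.le (by positivity)
    rw [ENNReal.ofReal_add hη.1.le (by have := hη.1; positivity),
      ENNReal.ofReal_add hη.1.le (by have := hη.1; positivity)]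
    refine (measure_mono (t := {ω | η ≤ |φ.integral W t ω - (J ω - J' ω)|} ∪
      {ω | d / 2 ≤ |φ.integral W t ω|}) fun ω hω => ?_).trans
      ((measure_union_le _ _).trans (add_le_add h2 (h3.trans (add_le_add h1 le_rfl))))
    by_contra hcon
    simp only [mem_union, mem_ofPred_eq, not_or, not_le] at hcon hω
    have h4 := abs_sub_le (J ω - J' ω) (φ.integral W t ω) 0
    rw [sub_zero, sub_zero, abs_sub_comm (J ω - J' ω)] at h4
    linarith [hcon.1, hcon.2, hη.2]
  have hall : ∀ᵐ ω ∂μ, ∀ n : ℕ, |J ω - J' ω| < 1 / ((n : ℝ) + 1) := by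
    rw [ae_all_iff]
    intro n
    have := key _ (Nat.one_div_pos_of_nat (n := n) (α := ℝ))
    rw [ae_iff]
    simpa only [not_lt] using this
  filter_upwards [hall] with ω hω
  have : |J ω - J' ω| ≤ 0 :=
    ge_of_tendsto' (tendsto_one_div_add_atTop_nhds_zero_nat (𝕜 := ℝ)) fun n => (hω n).le
  exact sub_eq_zero.1 (abs_nonpos_iff.1 this)
end

/-! ### Riemann sums -/

/-- Right-endpoint Riemann sums of a bounded, almost everywhere continuous function converge. -/
lemma tendsto_riemannSum {F : ℝ → ℝ} (hF : Measurable F) {t C : ℝ} (ht : 0 ≤ t)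
    (hC : ∀ s ∈ Icc 0 t, |F s| ≤ C) (hc : ∀ᵐ s, ContinuousAt F s) :
    Tendsto (fun N : ℕ => ∑ i ∈ Finset.range (N + 1),
      t / ((N : ℝ) + 1) * F (((i : ℝ) + 1) * t / ((N : ℝ) + 1))) atTop
      (𝓝 (∫ s in (0 : ℝ)..t, F s)) := by
  rcases ht.eq_or_lt with rfl | ht
  · simp
  -- the right endpoint of the interval of the partition that contains `s`
  let c : ℕ → ℝ → ℝ := fun N s => (⌈s * ((N : ℝ) + 1) / t⌉₊ : ℝ) * t / ((N : ℝ) + 1)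
  have hN : ∀ N : ℕ, (0 : ℝ) < (N : ℝ) + 1 := fun N => by positivity
  have hcm : ∀ N, Measurable (c N) := fun N => by
    refine ((measurable_from_nat (f := fun n : ℕ => (n : ℝ))).comp
      (Nat.measurable_ceil.comp ?_)).mul_const t |>.div_const _
    fun_prop
  have hcge : ∀ N s, s ≤ c N s := fun N s => by
    have := Nat.le_ceil (s * ((N : ℝ) + 1) / t)
    rw [div_le_iff₀ ht] at this
    exact (le_div_iff₀ (hN N)).2 this
  have hclt : ∀ N s, 0 ≤ s → c N s ≤ s + t / ((N : ℝ) + 1) := fun N s hs => by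
    have := (Nat.ceil_lt_add_one (a := s * ((N : ℝ) + 1) / t) (by have := hN N; positivity)).le
    have h2 := mul_le_mul_of_nonneg_right this ht.le
    simp only [c]
    rw [div_le_iff₀ (hN N), add_mul, div_mul_cancel₀ _ (hN N).ne']
    rw [add_mul, div_mul_cancel₀ _ ht.ne', one_mul] at h2
    exact h2
  have hcle : ∀ N s, s ∈ Ioc 0 t → c N s ∈ Icc 0 t := fun N s hs => by
    refine ⟨hs.1.le.trans (hcge N s), ?_⟩
    have : ⌈s * ((N : ℝ) + 1) / t⌉₊ ≤ N + 1 := Nat.ceil_le.2 (by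
      rw [div_le_iff₀ ht]; push_cast; nlinarith [hs.2, hN N])
    have h1 : (⌈s * ((N : ℝ) + 1) / t⌉₊ : ℝ) ≤ (N : ℝ) + 1 := by exact_mod_cast this
    simp only [c]
    rw [div_le_iff₀ (hN N)]
    nlinarith
  have hsum : ∀ N : ℕ, ∑ i ∈ Finset.range (N + 1),
      t / ((N : ℝ) + 1) * F (((i : ℝ) + 1) * t / ((N : ℝ) + 1)) =
        ∫ s in (0 : ℝ)..t, F (c N s) := by
    intro N
    let a : ℕ → ℝ := fun i => (i : ℝ) * t / ((N : ℝ) + 1)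
    have hab : ∀ i, a i ≤ a (i + 1) := fun i => by
      simp only [a]
      have := hN N
      push_cast
      gcongr
      linarith
    have hcst : ∀ i, ∀ s ∈ Ioc (a i) (a (i + 1)), F (c N s) =
        F (((i : ℝ) + 1) * t / ((N : ℝ) + 1)) := by
      intro i s hs
      have : ⌈s * ((N : ℝ) + 1) / t⌉₊ = i + 1 := by
        rw [Nat.ceil_eq_iff (Nat.succ_ne_zero i)]
        simp only [a, mem_Ioc] at hs
        rw [div_lt_iff₀ (hN N), le_div_iff₀ (hN N)] at hs
        constructor
        · rw [lt_div_iff₀ ht]; simpa using hs.1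
        · rw [div_le_iff₀ ht]; exact hs.2
      simp only [c, this]
      push_cast
      rfl
    have hcst' : ∀ i, ∀ s ∈ uIoc (a i) (a (i + 1)), F (c N s) =
        F (((i : ℝ) + 1) * t / ((N : ℝ) + 1)) := fun i s hs =>
      hcst i s (by rwa [uIoc_of_le (hab i)] at hs)
    have hint : ∀ i < N + 1, IntervalIntegrable (fun s => F (c N s)) volume (a i) (a (i + 1)) :=
      fun i _ => (intervalIntegrable_congr (hcst' i)).2 intervalIntegrable_const
    have h0 : a 0 = 0 := by simp [a]
    have h1 : a (N + 1) = t := by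
      simp only [a]; push_cast; field_simp
    have hadj := intervalIntegral.sum_integral_adjacent_intervals (n := N + 1) hint
    rw [h0, h1] at hadj
    rw [← hadj]
    refine Finset.sum_congr rfl fun i _ => ?_
    rw [intervalIntegral.integral_congr_ae (g := fun _ => F (((i : ℝ) + 1) * t / ((N : ℝ) + 1)))
      (ae_of_all _ (hcst' i)), intervalIntegral.integral_const, smul_eq_mul]
    congr 1
    simp only [a]
    push_cast
    ring
  simp only [hsum]
  refine intervalIntegral.tendsto_integral_filter_of_dominated_convergence (fun _ => C)
    (Eventually.of_forall fun N => (hF.comp (hcm N)).aestronglyMeasurable)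
    (Eventually.of_forall fun N => ae_of_all _ fun s hs => ?_) intervalIntegrable_const ?_
  · rw [uIoc_of_le ht.le] at hs
    exact hC _ (hcle N s hs)
  · filter_upwards [hc] with s hs hs'
    rw [uIoc_of_le ht.le] at hs'
    refine hs.tendsto.comp ?_
    have hlim : Tendsto (fun N : ℕ => s + t / ((N : ℝ) + 1)) atTop (𝓝 s) := by
      have := (tendsto_one_div_add_atTop_nhds_zero_nat (𝕜 := ℝ)).const_mul t
      simpa [div_eq_mul_inv] using this.const_add s
    exact tendsto_of_tendsto_of_tendsto_of_le_of_le tendsto_const_nhds hlim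
      (fun N => hcge N s) (fun N => hclt N s hs'.1.le)

/-! ### Deterministic kernels against a continuous process -/

section
variable {Ω : Type*} {mΩ : MeasurableSpace Ω} {μ : Measure Ω} {ℱ : Filtration ℝ≥0 mΩ}
  {W σ : ℝ≥0 → Ω → ℝ}

lemma eventually_measure_le_of_tendsto_ae [IsFiniteMeasure μ] {f : ℕ → Ω → ℝ≥0∞}
    (hf : ∀ N, Measurable (f N)) (h : ∀ᵐ ω ∂μ, Tendsto (fun N => f N ω) atTop (𝓝 0)) {δ : ℝ}
    (hδ : 0 < δ) : ∀ᶠ N in atTop, μ {ω | ENNReal.ofReal δ ≤ f N ω} ≤ ENNReal.ofReal δ := by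
  have hδ' : 0 < ENNReal.ofReal δ := ENNReal.ofReal_pos.2 hδ
  have hs : ∀ N, MeasurableSet {ω | ENNReal.ofReal δ ≤ f N ω} := fun N =>
    measurableSet_le measurable_const (hf N)
  have hlim : Tendsto (fun N => ∫⁻ ω, {ω | ENNReal.ofReal δ ≤ f N ω}.indicator 1 ω ∂μ) atTop
      (𝓝 (∫⁻ _, 0 ∂μ)) := by
    refine tendsto_lintegral_of_dominated_convergence (fun _ => 1)
      (fun N => measurable_one.indicator (hs N)) (fun N => ae_of_all _ fun ω => ?_) (by simp) ?_
    · by_cases hω : ω ∈ {ω | ENNReal.ofReal δ ≤ f N ω}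
      · simp [indicator_of_mem hω]
      · simp [indicator_of_notMem hω]
    · filter_upwards [h] with ω hω
      refine tendsto_const_nhds.congr' ?_
      filter_upwards [hω.eventually (eventually_lt_nhds hδ')] with N hN
      exact (indicator_of_notMem (s := {ω | ENNReal.ofReal δ ≤ f N ω}) (not_le.2 hN)
        (1 : Ω → ℝ≥0∞)).symm
  simp only [lintegral_indicator_one (hs _), lintegral_zero] at hlim
  exact hlim.eventually (eventually_le_nhds hδ')

/-- Stopping the time variable at `t` turns progressive measurability into joint measurability on
`ℝ × Ω`. -/
lemma MeasureTheory.IsStronglyProgressive.measurable_uncurry_min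
    (hσ : IsStronglyProgressive ℱ σ) (t : ℝ≥0) :
    Measurable fun p : ℝ × Ω => σ (min p.1.toNNReal t) p.2 := by
  have h1 : Measurable fun p : Iic t × Ω => σ p.1 p.2 :=
    (hσ t).measurable.mono (sup_le_sup le_rfl (MeasurableSpace.comap_mono (ℱ.le t))) le_rfl
  have h2 : Measurable fun p : ℝ × Ω =>
      ((⟨min p.1.toNNReal t, mem_Iic.2 (min_le_right _ _)⟩, p.2) : Iic t × Ω) :=
    (((measurable_real_toNNReal.comp measurable_fst).min measurable_const).subtype_mk).prodMk
      measurable_snd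
  exact h1.comp h2

lemma min_toNNReal_eq {t : ℝ≥0} {s : ℝ} (hs : s ∈ Icc (0 : ℝ) t) :
    min s.toNNReal t = s.toNNReal :=
  min_eq_left (Real.toNNReal_le_iff_le_coe.2 hs.2)

lemma MeasureTheory.IsStronglyProgressive.aemeasurable_path (hσ : IsStronglyProgressive ℱ σ)
    (t : ℝ≥0) (ω : Ω) :
    AEMeasurable (fun s : ℝ => σ s.toNNReal ω) (volume.restrict (Icc (0 : ℝ) t)) := by
  have h : Measurable fun s : ℝ => σ (min s.toNNReal t) ω :=
    (hσ.measurable_uncurry_min t).comp (measurable_id.prodMk measurable_const)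
  refine h.aemeasurable.congr ?_
  filter_upwards [ae_restrict_mem measurableSet_Icc] with s hs
  rw [min_toNNReal_eq hs]

lemma MeasureTheory.IsStronglyProgressive.const_kernel_mul (hσ : IsStronglyProgressive ℱ σ)
    {h : ℝ → ℝ}
    (hh : Measurable h) : IsStronglyProgressive ℱ fun s ω => h s * σ s ω := by
  intro i
  refine StronglyMeasurable.mul ?_ (hσ i)
  have h1 : Measurable fun s : Iic i => h ((s : ℝ≥0) : ℝ) :=
    hh.comp (measurable_coe_nnreal_real.comp measurable_subtype_coe)
  exact h1.stronglyMeasurable.comp_measurable (@measurable_fst _ _ _ (ℱ i))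

lemma exists_abs_path_le {t : ℝ≥0} {ω : Ω} (hω : Continuous fun t => σ t ω) :
    ∃ M : ℝ, ∀ s ∈ Icc (0 : ℝ) t, |σ s.toNNReal ω| ≤ M :=
  isCompact_Icc.exists_bound_of_continuousOn
    (hω.comp continuous_real_toNNReal).continuousOn

lemma lintegral_kernel_mul_sq_lt_top {t : ℝ≥0} {ω : Ω} (hω : Continuous fun t => σ t ω) {h : ℝ → ℝ}
    {C : ℝ} (hC : ∀ s ∈ Icc (0 : ℝ) t, |h s| ≤ C) :
    ∫⁻ s in Icc (0 : ℝ) t, ENNReal.ofReal ((h s * σ s.toNNReal ω) ^ 2) < ∞ := by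
  obtain ⟨M, hM⟩ := exists_abs_path_le (t := t) hω
  refine setLIntegral_lt_top_of_le_nnreal (by simp) ⟨((C * M) ^ 2).toNNReal, fun s hs => ?_⟩
  refine ENNReal.ofReal_le_ofReal (sq_le_sq.2 ?_)
  have h1 := hC s hs
  have h2 := hM s hs
  rw [abs_mul, abs_mul]
  exact mul_le_mul (h1.trans (le_abs_self _)) (h2.trans (le_abs_self _)) (abs_nonneg _)
    (abs_nonneg _)

/-- Itô integrals of `h_N σ` converge when the deterministic kernels `h_N` converge boundedly on
`[0, t]`. -/
lemma HasItoApprox.of_tendsto_kernel [IsFiniteMeasure μ] (hσ : IsStronglyProgressive ℱ σ)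
    (hσc : ∀ᵐ ω ∂μ, Continuous fun t => σ t ω) {t : ℝ≥0} {h : ℕ → ℝ → ℝ} {h' : ℝ → ℝ}
    (hm : ∀ N, Measurable (h N)) (hm' : Measurable h') {C : ℝ}
    (hC : ∀ N, ∀ s ∈ Icc (0 : ℝ) t, |h N s| ≤ C)
    (hlim : ∀ s ∈ Icc (0 : ℝ) t, Tendsto (fun N => h N s) atTop (𝓝 (h' s)))
    {I : ℕ → Ω → ℝ} {J : Ω → ℝ}
    (hI : ∀ N, HasItoApprox μ ℱ W (fun s ω => h N s * σ s ω) t (I N))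
    (hIm : ∀ N, AEStronglyMeasurable (I N) μ)
    (hIJ : ∀ᵐ ω ∂μ, Tendsto (fun N => I N ω) atTop (𝓝 (J ω))) :
    HasItoApprox μ ℱ W (fun s ω => h' s * σ s ω) t J := by
  have hC' : ∀ s ∈ Icc (0 : ℝ) t, |h' s| ≤ C := fun s hs =>
    le_of_tendsto' (hlim s hs).abs fun N => hC N s hs
  refine HasItoApprox.of_tendsto hI
    (fun N ω => (hσ.const_kernel_mul (hm N)).aemeasurable_path t ω) (fun δ hδ => ?_)
    fun δ hδ => ?_
  · have hrw : ∀ N ω, ∫⁻ s in Icc (0 : ℝ) t, ENNReal.ofReal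
        ((h N s.toNNReal * σ s.toNNReal ω - h' s.toNNReal * σ s.toNNReal ω) ^ 2) =
        ∫⁻ s in Icc (0 : ℝ) t, ENNReal.ofReal (((h N s - h' s) * σ (min s.toNNReal t) ω) ^ 2) := by
      intro N ω
      refine setLIntegral_congr_fun measurableSet_Icc fun s hs => ?_
      rw [Real.coe_toNNReal s hs.1, min_toNNReal_eq hs, sub_mul]
    simp only [hrw]
    refine eventually_measure_le_of_tendsto_ae (fun N => ?_) ?_ hδ
    · refine Measurable.lintegral_prod_left'
        (f := fun p : ℝ × Ω => ENNReal.ofReal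
          (((h N p.1 - h' p.1) * σ (min p.1.toNNReal t) p.2) ^ 2)) ?_
      exact (((((hm N).sub hm').comp measurable_fst).mul
        (hσ.measurable_uncurry_min t)).pow_const 2).ennreal_ofReal
    · filter_upwards [hσc] with ω hω
      obtain ⟨M, hM⟩ := exists_abs_path_le (t := t) hω
      have h0 : (0 : ℝ≥0∞) = ∫⁻ s in Icc (0 : ℝ) t, 0 := by simp
      rw [h0]
      refine tendsto_lintegral_of_dominated_convergence
        (fun _ => ENNReal.ofReal (((2 * C) * M) ^ 2)) (fun N => ?_) (fun N => ?_)
        (by simp [ENNReal.mul_eq_top]) ?_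
      · exact ((((hm N).sub hm').mul ((hσ.measurable_uncurry_min t).comp
          (measurable_id.prodMk measurable_const))).pow_const 2).ennreal_ofReal
      · filter_upwards [ae_restrict_mem measurableSet_Icc] with s hs
        refine ENNReal.ofReal_le_ofReal (sq_le_sq.2 ?_)
        rw [min_toNNReal_eq hs, abs_mul, abs_mul _ M]
        refine mul_le_mul ?_ ((hM s hs).trans (le_abs_self _)) (abs_nonneg _) (abs_nonneg _)
        refine le_trans ?_ (le_abs_self _)
        have := abs_sub (h N s) (h' s)
        linarith [hC N s hs, hC' s hs]
      · filter_upwards [ae_restrict_mem measurableSet_Icc] with s hs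
        have h1 : Tendsto (fun N => ENNReal.ofReal
            (((h N s - h' s) * σ (min s.toNNReal t) ω) ^ 2)) atTop
            (𝓝 (ENNReal.ofReal (((h' s - h' s) * σ (min s.toNNReal t) ω) ^ 2))) :=
          (ENNReal.continuous_ofReal.tendsto _).comp
            ((((hlim s hs).sub_const _).mul_const _).pow 2)
        simpa using h1
  · have := tendstoInMeasure_of_tendsto_ae hIm hIJ
    rw [tendstoInMeasure_iff_dist] at this
    exact (this δ hδ).eventually (eventually_le_nhds (ENNReal.ofReal_pos.2 hδ))

/-- Stochastic Fubini for the resolvent identity: if `V` is the convolution of `K` with `σ dW` and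
`K' = g₀ K + g' * K`, then the convolution of `K'` with `σ dW` is `g₀ V + g' * V`. The integral
`g' * V` is a pathwise limit of Riemann sums, which are Itô integrals of kernels converging
boundedly to `g' * K`. -/
lemma HasItoApprox.volterra [IsFiniteMeasure μ] (hσ : IsStronglyProgressive ℱ σ)
    (hσc : ∀ᵐ ω ∂μ, Continuous fun t => σ t ω) {K K' g' : ℝ → ℝ} {g₀ : ℝ}
    (hKm : Measurable K) (hK'm : Measurable K') (hK : ContinuousOn K (Ici 0))
    (hg' : ContinuousOn g' (Ici 0))
    (hid : ∀ t, 0 ≤ t → K' t = g₀ * K t + volterraConv g' K t) {V : ℝ≥0 → Ω → ℝ}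
    (hVm : ∀ t, AEStronglyMeasurable (V t) μ) (hVc : ∀ᵐ ω ∂μ, Continuous fun t => V t ω)
    (hV : ∀ t : ℝ≥0, HasItoApprox μ ℱ W (fun s ω => K (t - s) * σ s ω) t (V t)) (t : ℝ≥0) :
    HasItoApprox μ ℱ W (fun s ω => K' (t - s) * σ s ω) t
      (fun ω => g₀ * V t ω + ∫ s in (0 : ℝ)..t, g' (t - s) * V s.toNNReal ω) := by
  have hKb := continuous_comp_max hK
  have hgb := continuous_comp_max hg'
  obtain ⟨CK, hCK⟩ := (isCompact_Icc (a := (0 : ℝ)) (b := t)).exists_bound_of_continuousOn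
    (hK.mono Icc_subset_Ici_self)
  obtain ⟨CG, hCG⟩ := (isCompact_Icc (a := (0 : ℝ)) (b := t)).exists_bound_of_continuousOn
    (hg'.mono Icc_subset_Ici_self)
  simp only [Real.norm_eq_abs] at hCK hCG
  have h0t : (0 : ℝ) ∈ Icc (0 : ℝ) t := ⟨le_rfl, t.coe_nonneg⟩
  have hCK0 : 0 ≤ CK := (abs_nonneg _).trans (hCK 0 h0t)
  have hCG0 : 0 ≤ CG := (abs_nonneg _).trans (hCG 0 h0t)
  let τ : ℕ → ℕ → ℝ≥0 := fun N i => ((i : ℝ≥0) + 1) * t / ((N : ℝ≥0) + 1)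
  have hτ : ∀ N i, (τ N i : ℝ) = ((i : ℝ) + 1) * t / ((N : ℝ) + 1) := fun N i => by
    simp [τ]
  have hτt : ∀ N i, i ∈ Finset.range (N + 1) → τ N i ≤ t := fun N i hi => by
    rw [← NNReal.coe_le_coe, hτ, div_le_iff₀ (by positivity), mul_comm]
    have : (i : ℝ) + 1 ≤ (N : ℝ) + 1 := by
      have := Finset.mem_range.1 hi
      exact_mod_cast this
    exact mul_le_mul_of_nonneg_left this t.coe_nonneg
  let w : ℕ → ℕ → ℝ := fun N i => (t : ℝ) / ((N : ℝ) + 1) * g' (t - τ N i)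
  let h : ℕ → ℝ → ℝ := fun N r => g₀ * K (t - r) +
    ∑ i ∈ Finset.range (N + 1), w N i * (if r ≤ τ N i then K (τ N i - r) else 0)
  have hm : ∀ N, Measurable (h N) := fun N => by
    refine ((hKm.comp (by fun_prop)).const_mul g₀).add
      (Finset.measurable_fun_sum _ fun i _ => Measurable.const_mul ?_ _)
    exact Measurable.ite measurableSet_Iic (hKm.comp (by fun_prop)) measurable_const
  -- the Riemann sums of `F r` give the sum in `h N r`
  let F : ℝ → ℝ → ℝ := fun r s => (Ici r).indicator
    (fun s => g' (max (t - s) 0) * K (max (s - r) 0)) s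
  have hFterm : ∀ (N : ℕ) (r : ℝ), ∀ i ∈ Finset.range (N + 1),
      w N i * (if r ≤ τ N i then K (τ N i - r) else 0) =
        (t : ℝ) / ((N : ℝ) + 1) * F r (((i : ℝ) + 1) * t / ((N : ℝ) + 1)) := by
    intro N r i hi
    have h1 : (0 : ℝ) ≤ t - τ N i := sub_nonneg.2 (NNReal.coe_le_coe.2 (hτt N i hi))
    simp only [w, F, ← hτ, max_eq_left h1, indicator_apply, mem_Ici]
    split_ifs with hr
    · rw [max_eq_left (sub_nonneg.2 hr), mul_assoc]
    · simp
  have hFb : ∀ r ∈ Icc (0 : ℝ) t, ∀ s ∈ Icc (0 : ℝ) t, |F r s| ≤ CG * CK := by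
    intro r hr s hs
    simp only [F, indicator_apply, mem_Ici]
    split_ifs with hrs
    · rw [max_eq_left (sub_nonneg.2 hs.2), max_eq_left (sub_nonneg.2 hrs), abs_mul]
      exact mul_le_mul (hCG _ ⟨sub_nonneg.2 hs.2, by linarith [hs.1]⟩)
        (hCK _ ⟨sub_nonneg.2 hrs, by linarith [hr.1, hs.2]⟩) (abs_nonneg _) hCG0
    · simpa using mul_nonneg hCG0 hCK0
  have hFc : ∀ r, Continuous fun s => g' (max (t - s) 0) * K (max (s - r) 0) := fun r =>
    (hgb.comp (by fun_prop : Continuous fun s : ℝ => (t : ℝ) - s)).mul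
      (hKb.comp (by fun_prop : Continuous fun s : ℝ => s - r))
  have hFint : ∀ r ∈ Icc (0 : ℝ) t, ∫ s in (0 : ℝ)..t, F r s = volterraConv g' K (t - r) := by
    intro r hr
    have hsub := intervalIntegral.integral_comp_sub_right (a := r) (b := t)
      (fun u => g' (t - r - u) * K u) r
    rw [sub_self] at hsub
    rw [volterraConv, ← hsub, intervalIntegral.integral_of_le t.coe_nonneg,
      intervalIntegral.integral_of_le hr.2, ← integral_Icc_eq_integral_Ioc,
      ← integral_Icc_eq_integral_Ioc (x := r)]
    simp only [F]
    rw [setIntegral_indicator measurableSet_Ici, show Icc (0 : ℝ) t ∩ Ici r = Icc r t by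
      ext x; simp only [mem_inter_iff, mem_Icc, mem_Ici]
      exact ⟨fun h => ⟨h.2, h.1.2⟩, fun h => ⟨⟨hr.1.trans h.1, h.2⟩, h.1⟩⟩]
    refine setIntegral_congr_fun measurableSet_Icc fun s hs => ?_
    rw [max_eq_left (sub_nonneg.2 hs.2), max_eq_left (sub_nonneg.2 hs.1)]
    congr 2
    ring
  have hC : ∀ N, ∀ r ∈ Icc (0 : ℝ) t, |h N r| ≤ |g₀| * CK + t * (CG * CK) := by
    intro N r hr
    refine (abs_add_le _ _).trans (add_le_add ?_ ?_)
    · rw [abs_mul]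
      exact mul_le_mul_of_nonneg_left (hCK _ ⟨sub_nonneg.2 hr.2, by linarith [hr.1]⟩) (abs_nonneg _)
    · have hN : (0 : ℝ) < (N : ℝ) + 1 := by positivity
      rw [Finset.sum_congr rfl (hFterm N r)]
      refine (Finset.abs_sum_le_sum_abs _ _).trans ((Finset.sum_le_card_nsmul _ _
        ((t : ℝ) / ((N : ℝ) + 1) * (CG * CK)) fun i hi => ?_).trans (le_of_eq ?_))
      · rw [abs_mul, abs_of_nonneg (by positivity : (0 : ℝ) ≤ (t : ℝ) / ((N : ℝ) + 1)), ← hτ]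
        exact mul_le_mul_of_nonneg_left
          (hFb r hr _ ⟨(τ N i).coe_nonneg, NNReal.coe_le_coe.2 (hτt N i hi)⟩) (by positivity)
      · rw [Finset.card_range, nsmul_eq_mul]
        push_cast
        field_simp
  have hlim : ∀ r ∈ Icc (0 : ℝ) t, Tendsto (fun N => h N r) atTop (𝓝 (K' (t - r))) := by
    intro r hr
    rw [hid _ (sub_nonneg.2 hr.2), ← hFint r hr]
    refine Tendsto.const_add _ ?_
    simp only [Finset.sum_congr rfl (hFterm _ r)]
    refine tendsto_riemannSum ((hFc r).measurable.indicator measurableSet_Ici) t.coe_nonneg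
      (hFb r hr) ?_
    -- `F r` is continuous off `r`, where the indicator jumps
    filter_upwards [compl_mem_ae_iff.2 (measure_singleton (μ := volume) r)] with s hs
    have : s ∉ frontier (Ici r) := by rwa [frontier_Ici]
    exact ((hFc r).continuousOn.continuousAt_indicator this)
  refine HasItoApprox.of_tendsto_kernel hσ hσc hm (hK'm.comp (by fun_prop)) hC hlim
    (I := fun N ω => g₀ * V t ω + ∑ i ∈ Finset.range (N + 1), w N i * V (τ N i) ω)
    (fun N => ?_) (fun N => ?_) ?_
  · have hpath : ∀ i : ℕ, ∀ ω, AEMeasurable (fun s : ℝ => w N i * (if s.toNNReal ≤ τ N i then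
        K (τ N i - s.toNNReal) * σ s.toNNReal ω else 0)) (volume.restrict (Icc (0 : ℝ) t)) := by
      intro i ω
      have h1 : Measurable fun s : ℝ => w N i * (if s ≤ τ N i then K (τ N i - s) else 0) :=
        (Measurable.ite measurableSet_Iic (hKm.comp (by fun_prop)) measurable_const).const_mul _
      refine ((hσ.const_kernel_mul h1).aemeasurable_path t ω).congr (ae_of_all _ fun s => ?_)
      simp only [NNReal.coe_le_coe]
      split_ifs <;> simp [mul_assoc]
    have hsum := ((hV t).const_mul g₀).add (HasItoApprox.sum (N := N + 1)
      (X := fun i s ω => w N i * (if s ≤ τ N i then K (τ N i - s) * σ s ω else 0))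
      (I := fun i ω => w N i * V (τ N i) ω)
      (fun i hi => ((hV (τ N i)).cutoff (hτt N i (Finset.mem_range.2 hi))).const_mul (w N i)) hpath)
      (fun ω => ((hσ.const_kernel_mul (h := fun s => K (t - s))
        (hKm.comp (by fun_prop))).aemeasurable_path t ω).const_mul g₀)
    convert hsum using 3 with s ω
    simp only [h, NNReal.coe_le_coe, add_mul, Finset.sum_mul, mul_assoc, ite_mul, zero_mul]
  · exact ((hVm t).const_mul g₀).add (Finset.aestronglyMeasurable_fun_sum _
      fun i _ => (hVm (τ N i)).const_mul _)
  · filter_upwards [hVc] with ω hω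
    have hc : Continuous fun s : ℝ => g' (max (t - s) 0) * V s.toNNReal ω :=
      (hgb.comp (by fun_prop : Continuous fun s : ℝ => (t : ℝ) - s)).mul
        (hω.comp continuous_real_toNNReal)
    obtain ⟨B, hB⟩ := (isCompact_Icc (a := (0 : ℝ)) (b := t)).exists_bound_of_continuousOn
      hc.continuousOn
    have hR := tendsto_riemannSum hc.measurable t.coe_nonneg hB
      (ae_of_all _ fun s => hc.continuousAt)
    have hint : ∫ s in (0 : ℝ)..t, g' (t - s) * V s.toNNReal ω =
        ∫ s in (0 : ℝ)..t, g' (max (t - s) 0) * V s.toNNReal ω := by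
      refine intervalIntegral.integral_congr fun s hs => ?_
      rw [uIcc_of_le t.coe_nonneg] at hs
      simp only [max_eq_left (sub_nonneg.2 hs.2)]
    rw [hint]
    refine Tendsto.const_add _ (hR.congr fun N => Finset.sum_congr rfl fun i hi => ?_)
    have h1 : (0 : ℝ) ≤ t - τ N i := sub_nonneg.2 (NNReal.coe_le_coe.2 (hτt N i hi))
    simp only [w, ← hτ, max_eq_left h1, Real.toNNReal_coe, mul_assoc]
end

/-! ### The resolvent identity for the solution of the Volterra equation -/

lemma volterraConv_const_right (a : ℝ → ℝ) (θ t : ℝ) :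
    volterraConv a (fun _ => θ) t = θ * ∫ s in (0 : ℝ)..t, a s := by
  rw [volterraConv_comm, volterraConv, intervalIntegral.integral_const_mul]

/-- The identity `K' = g₀ K + g' * K` convolved with a constant. -/
lemma volterraConv_const_of_identity {K K' g' : ℝ → ℝ} {g₀ : ℝ} (hK : ContinuousOn K (Ici 0))
    (hg' : ContinuousOn g' (Ici 0))
    (hid : ∀ t, 0 ≤ t → K' t = g₀ * K t + volterraConv g' K t) (θ : ℝ) {t : ℝ} (ht : 0 ≤ t) :
    volterraConv K' (fun _ => θ) t = g₀ * volterraConv K (fun _ => θ) t +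
      volterraConv g' (volterraConv K fun _ => θ) t := by
  have hsub : uIcc 0 t ⊆ Ici (0 : ℝ) := by rw [uIcc_of_le ht]; exact Icc_subset_Ici_self
  have hKi : IntervalIntegrable (fun s => g₀ * K s) volume 0 t :=
    (continuousOn_const.mul (hK.mono hsub)).intervalIntegrable
  have h1 : ∫ s in (0 : ℝ)..t, K' s =
      g₀ * (∫ s in (0 : ℝ)..t, K s) + ∫ s in (0 : ℝ)..t, volterraConv g' K s := by
    rw [← intervalIntegral.integral_const_mul, ← intervalIntegral.integral_add hKi
      ((continuousOn_volterraConv hg' hK).mono hsub).intervalIntegrable]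
    exact intervalIntegral.integral_congr fun s hs => hid s (hsub hs)
  have h2 : ∫ s in (0 : ℝ)..t, volterraConv g' K s =
      volterraConv g' (fun s => ∫ r in (0 : ℝ)..s, K r) t := by
    rw [volterraConv_comm g', intervalIntegral.integral_congr (g := volterraConv
      (fun s => K (max s 0)) fun s => g' (max s 0)),
      integral_volterraConv (continuous_comp_max hK) (continuous_comp_max hg') ht]
    · refine intervalIntegral.integral_congr fun s hs => ?_
      rw [uIcc_of_le ht] at hs
      have hs' : 0 ≤ t - s := sub_nonneg.2 hs.2
      simp only [max_eq_left hs.1]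
      congr 1
      refine intervalIntegral.integral_congr fun r hr => ?_
      rw [uIcc_of_le hs'] at hr
      simp only [max_eq_left hr.1]
    · intro s hs
      rw [volterraConv_comm g']
      exact volterraConv_congr (eqOn_comp_max K) (eqOn_comp_max g') (hsub hs)
  have h3 : volterraConv g' (volterraConv K fun _ => θ) t =
      θ * volterraConv g' (fun s => ∫ r in (0 : ℝ)..s, K r) t := by
    rw [volterraConv, volterraConv, ← intervalIntegral.integral_const_mul]
    refine intervalIntegral.integral_congr fun s _ => ?_
    change g' (t - s) * volterraConv K (fun _ => θ) s = _
    rw [volterraConv_const_right]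
    ring
  rw [h3, ← h2, volterraConv_const_right, volterraConv_const_right, h1]
  ring

section
variable {Ω : Type*} {mΩ : MeasurableSpace Ω} {μ : Measure Ω} {ℱ : Filtration ℝ≥0 mΩ}
  {W : ℝ≥0 → Ω → ℝ}

/-- For a continuous process `U` with `U - U₀ = K * dZ`, `dZ = θ dt + ξ √U dW`, and a kernel
`K' = g₀ K + g' * K`, the process `g₀ (U - U₀) + g' * (U - U₀)` is continuous and is a version of
`K' * dZ`; by uniqueness of the Itô integral, every version agrees with it at each time. -/
theorem volterra_integral_of_identity [IsProbabilityMeasure μ] (hW : IsFiltrationBrownian μ ℱ W)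
    {U : ℝ≥0 → Ω → ℝ} {U₀ θ ξ : ℝ} (hU : IsStronglyProgressive ℱ U)
    (hUc : ∀ᵐ ω ∂μ, Continuous fun t => U t ω) {K K' g' : ℝ → ℝ} {g₀ : ℝ}
    (hKm : Measurable K) (hK'm : Measurable K') (hK : ContinuousOn K (Ici 0))
    (hK' : ContinuousOn K' (Ici 0)) (hg' : ContinuousOn g' (Ici 0))
    (hid : ∀ t, 0 ≤ t → K' t = g₀ * K t + volterraConv g' K t)
    (heq : ∀ t : ℝ≥0, IsZIntegral μ ℱ W θ ξ U (fun s => K (t - s)) t (fun ω => U t ω - U₀)) :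
    (∃ D : ℝ≥0 → Ω → ℝ,
      (∀ t : ℝ≥0, IsZIntegral μ ℱ W θ ξ U (fun s => K' (t - s)) t (D t)) ∧
      (∀ᵐ ω ∂μ, Continuous fun t => D t ω) ∧
      ∀ᵐ ω ∂μ, ∀ t : ℝ≥0, D t ω = g₀ * (U t ω - U₀) +
        ∫ s in (0 : ℝ)..t, g' (t - s) * (U s.toNNReal ω - U₀)) ∧
    ∀ (t : ℝ≥0) (X : Ω → ℝ), IsZIntegral μ ℱ W θ ξ U (fun s => K' (t - s)) t X →
      ∀ᵐ ω ∂μ, X ω = g₀ * (U t ω - U₀) +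
        ∫ s in (0 : ℝ)..t, g' (t - s) * (U s.toNNReal ω - U₀) := by
  let σ : ℝ≥0 → Ω → ℝ := fun s ω => ξ * √(U s ω)
  have hσ : IsStronglyProgressive ℱ σ := fun i =>
    (continuous_const.mul Real.continuous_sqrt : Continuous fun x : ℝ => ξ * √x)
      |>.comp_stronglyMeasurable (hU i)
  have hσc : ∀ᵐ ω ∂μ, Continuous fun t => σ t ω := by
    filter_upwards [hUc] with ω hω
    exact continuous_const.mul hω.sqrt
  -- the martingale part of `U - U₀`
  let V : ℝ≥0 → Ω → ℝ := fun t ω => U t ω - U₀ - volterraConv K (fun _ => θ) t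
  have hdrift : Continuous fun t : ℝ≥0 => volterraConv K (fun _ => θ) t :=
    (continuousOn_volterraConv hK continuousOn_const).comp_continuous NNReal.continuous_coe
      fun t => t.coe_nonneg
  have hVm : ∀ t, AEStronglyMeasurable (V t) μ := fun t =>
    ((((hU.stronglyAdapted t).mono (ℱ.le t)).aestronglyMeasurable).sub
      aestronglyMeasurable_const).sub aestronglyMeasurable_const
  have hVc : ∀ᵐ ω ∂μ, Continuous fun t => V t ω := by
    filter_upwards [hUc] with ω hω
    exact (hω.sub continuous_const).sub hdrift
  have hV : ∀ t : ℝ≥0, HasItoApprox μ ℱ W (fun s ω => K (t - s) * σ s ω) t (V t) := by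
    intro t
    obtain ⟨-, J, hJ, hae⟩ := heq t
    refine hJ.hasItoApprox.congr_ae ?_
    filter_upwards [hae] with ω hω
    simp only [V, volterraConv]
    rw [hω, add_sub_cancel_left]
  have hJ := HasItoApprox.volterra hσ hσc hKm hK'm hK hg' hid hVm hVc hV
  let D : ℝ≥0 → Ω → ℝ := fun t ω => g₀ * (U t ω - U₀) +
    ∫ s in (0 : ℝ)..t, g' (t - s) * (U s.toNNReal ω - U₀)
  -- `D` is the sum of the drift and the martingale part of `K' * dZ`
  have hD : ∀ᵐ ω ∂μ, ∀ t : ℝ≥0, D t ω = volterraConv K' (fun _ => θ) t +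
      (g₀ * V t ω + ∫ s in (0 : ℝ)..t, g' (t - s) * V s.toNNReal ω) := by
    filter_upwards [hUc] with ω hω t
    have hgc : ContinuousOn (fun s : ℝ => g' (t - s)) (uIcc 0 t) :=
      hg'.comp (by fun_prop) fun s hs => by
        rw [uIcc_of_le t.coe_nonneg] at hs
        exact sub_nonneg.2 hs.2
    have hUi : IntervalIntegrable (fun s : ℝ => g' (t - s) * (U s.toNNReal ω - U₀)) volume 0 t :=
      (hgc.mul ((hω.comp continuous_real_toNNReal).sub
        continuous_const).continuousOn).intervalIntegrable
    have hdi : IntervalIntegrable (fun s : ℝ => g' (t - s) *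
        volterraConv K (fun _ => θ) s) volume 0 t := by
      refine (hgc.mul
        ((continuousOn_volterraConv hK continuousOn_const).mono ?_)).intervalIntegrable
      rw [uIcc_of_le t.coe_nonneg]
      exact Icc_subset_Ici_self
    have hsplit : ∫ s in (0 : ℝ)..t, g' (t - s) * V s.toNNReal ω =
        (∫ s in (0 : ℝ)..t, g' (t - s) * (U s.toNNReal ω - U₀)) -
          volterraConv g' (volterraConv K fun _ => θ) t := by
      rw [volterraConv, ← intervalIntegral.integral_sub hUi hdi]
      refine intervalIntegral.integral_congr fun s hs => ?_
      rw [uIcc_of_le t.coe_nonneg] at hs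
      simp only [V, Real.coe_toNNReal s hs.1]
      ring
    rw [hsplit, volterraConv_const_of_identity hK hg' hid θ t.coe_nonneg]
    simp only [D, V]
    ring
  have hK'prog : ∀ t : ℝ≥0, IsStronglyProgressive ℱ fun s ω => K' (t - s) * σ s ω := fun t =>
    hσ.const_kernel_mul (h := fun s => K' (t - s)) (hK'm.comp (by fun_prop))
  refine ⟨⟨D, fun t => ⟨?_, _, (hJ t).isItoIntegral (hK'prog t) ?_, ?_⟩, ?_,
    ae_of_all _ fun _ _ => rfl⟩,
    fun t X hX => ?_⟩
  · refine ae_of_all _ fun ω => ContinuousOn.intervalIntegrable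
      (ContinuousOn.mul ?_ continuousOn_const)
    refine hK'.comp (by fun_prop) fun s hs => ?_
    rw [uIcc_of_le t.coe_nonneg] at hs
    exact sub_nonneg.2 hs.2
  · obtain ⟨C, hC⟩ := (isCompact_Icc (a := (0 : ℝ)) (b := t)).exists_bound_of_continuousOn
      (f := fun s => K' (t - s)) (hK'.comp (by fun_prop) fun s hs => sub_nonneg.2 hs.2)
    filter_upwards [hσc] with ω hω
    refine lt_of_le_of_lt (le_of_eq ?_) (lintegral_kernel_mul_sq_lt_top (t := t) hω hC)
    refine setLIntegral_congr_fun measurableSet_Icc fun s hs => ?_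
    simp only [Real.coe_toNNReal s hs.1]
  · filter_upwards [hD] with ω hω
    exact hω t
  · filter_upwards [hUc] with ω hω
    refine (continuous_const.mul (hω.sub continuous_const)).add ?_
    have hc : ContinuousOn (volterraConv g' fun s => U s.toNNReal ω - U₀) (Ici 0) :=
      continuousOn_volterraConv hg'
        ((hω.comp continuous_real_toNNReal).sub continuous_const).continuousOn
    exact hc.comp_continuous NNReal.continuous_coe fun t => t.coe_nonneg
  · obtain ⟨-, J, hJX, hXae⟩ := hX
    have huniq := hJX.hasItoApprox.ae_eq hW (hJ t)
      fun ω => (hK'prog t).aemeasurable_path t ω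
    filter_upwards [hXae, huniq, hD] with ω h1 h2 h3
    rw [h1, h2]
    exact (h3 t).symm
end

theorem lemma1p2 (H ε : ℝ) (hε : 0 < ε) (hH : H ∈ Ioo (-1 / 2 : ℝ) (1 / 2)) :
    ∃ (L : LocBVMeasure) (ℓ : ℝ → ℝ),
      -- `L` is a resolvent of the first kind, of the form `δ₀ / K(0) + ℓ(t) dt`
      IsResolventFirstKind (shiftedKernel H ε) L ∧
      LocallyIntegrableOn ℓ (Ici 0) ∧
      L.HasForm (shiftedKernel H ε 0)⁻¹ ℓ ∧
      -- `K' * L` is continuously differentiable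
      ContDiffOn ℝ 1 (LocBVMeasure.conv (deriv (shiftedKernel H ε)) L) (Ici 0) ∧
      -- the identity for the drift term
      ∀ (Ω : Type*) (mΩ : MeasurableSpace Ω) (μ : Measure Ω) [IsProbabilityMeasure μ]
        (ℱ : Filtration ℝ≥0 mΩ) (W : ℝ≥0 → Ω → ℝ) (U₀ θ ξ : ℝ) (U : ℝ≥0 → Ω → ℝ),
        IsFiltrationBrownian μ ℱ W →
        IsShiftedSpotVariance μ ℱ W H ε U₀ θ ξ U →
        -- the process `t ↦ ∫_0^t K'(t - s) dZ_s` exists, with continuous paths,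
        -- and satisfies the identity for all times simultaneously
        (∃ D : ℝ≥0 → Ω → ℝ,
          (∀ t : ℝ≥0,
            IsZIntegral μ ℱ W θ ξ U (fun s => deriv (shiftedKernel H ε) (t - s)) t (D t)) ∧
          (∀ᵐ ω ∂μ, Continuous fun t => D t ω) ∧
          ∀ᵐ ω ∂μ, ∀ t : ℝ≥0,
            D t ω = -(1 / 2 - H) * ε⁻¹ * (U t ω - U₀) +
              ∫ s in (0 : ℝ)..t,
                derivWithin (LocBVMeasure.conv (deriv (shiftedKernel H ε)) L) (Ici 0) (t - s) *
                  (U s.toNNReal ω - U₀)) ∧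
        -- and so does every version of the integral at each time
        (∀ (t : ℝ≥0) (X : Ω → ℝ),
          IsZIntegral μ ℱ W θ ξ U (fun s => deriv (shiftedKernel H ε) (t - s)) t X →
          ∀ᵐ ω ∂μ,
            X ω = -(1 / 2 - H) * ε⁻¹ * (U t ω - U₀) +
              ∫ s in (0 : ℝ)..t,
                derivWithin (LocBVMeasure.conv (deriv (shiftedKernel H ε)) L) (Ici 0) (t - s) *
                  (U s.toNNReal ω - U₀)) := by
  have hpos : ∀ t ∈ Ici (0 : ℝ), 0 < t + ε := fun t ht => add_pos_of_nonneg_of_pos ht hε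
  have hp : H - 1 / 2 < 0 := sub_neg.2 hH.2
  have hK : ∀ t ∈ Ici (0 : ℝ), HasDerivWithinAt (shiftedKernel H ε)
      (deriv (shiftedKernel H ε) t) (Ici 0) t := fun t ht =>
    (hasDerivAt_shiftedKernel H (hpos t ht)).differentiableAt.hasDerivAt.hasDerivWithinAt
  have hK' : ∀ t ∈ Ici (0 : ℝ), HasDerivWithinAt (deriv (shiftedKernel H ε))
      ((H - 1 / 2) * ((H - 1 / 2 - 1) * (t + ε) ^ (H - 1 / 2 - 1 - 1))) (Ici 0) t := fun t ht =>
    (hasDerivAt_deriv_shiftedKernel H (hpos t ht)).hasDerivWithinAt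
  have hK'' : ContinuousOn (fun t : ℝ => (H - 1 / 2) * ((H - 1 / 2 - 1) *
      (t + ε) ^ (H - 1 / 2 - 1 - 1))) (Ici 0) :=
    continuousOn_const.mul (continuousOn_const.mul
      ((continuousOn_id.add continuousOn_const).rpow_const fun t ht => Or.inl (hpos t ht).ne'))
  have hK0 : 0 < shiftedKernel H ε 0 := Real.rpow_pos_of_pos (hpos 0 self_mem_Ici) _
  have hbound : ∀ t, 0 ≤ t → |deriv (shiftedKernel H ε) t| ≤
      |H - 1 / 2| * ε ^ (H - 1 / 2 - 1) := by
    intro t ht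
    rw [(hasDerivAt_shiftedKernel H (hpos t ht)).deriv, abs_mul,
      abs_of_pos (Real.rpow_pos_of_pos (hpos t ht) _)]
    exact mul_le_mul_of_nonneg_left
      (Real.rpow_le_rpow_of_nonpos hε (by linarith) (by linarith)) (abs_nonneg _)
  obtain ⟨L, ℓ, g', hℓ, hres, hform, hg'c, hg', hid⟩ :=
    exists_resolventFirstKind hK hK' hK'' hK0 hbound
  have hcd := contDiffOn_one_Ici hg' hg'c
  refine ⟨L, ℓ, hres, hℓ.continuousOn.locallyIntegrableOn measurableSet_Ici, hform, hcd, ?_⟩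
  intro Ω mΩ μ _ ℱ W U₀ θ ξ U hW hU
  have hdw : EqOn (derivWithin (LocBVMeasure.conv (deriv (shiftedKernel H ε)) L) (Ici 0)) g'
      (Ici 0) := fun t ht => (hg' t ht).derivWithin (uniqueDiffOn_Ici 0 t ht)
  have hg₀ : (shiftedKernel H ε 0)⁻¹ * deriv (shiftedKernel H ε) 0 = -(1 / 2 - H) * ε⁻¹ := by
    rw [(hasDerivAt_shiftedKernel H (hpos 0 self_mem_Ici)).deriv, shiftedKernel, zero_add,
      Real.rpow_sub_one hε.ne']
    have := (Real.rpow_pos_of_pos hε (H - 1 / 2)).ne'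
    field_simp
    ring
  refine volterra_integral_of_identity hW hU.progressive hU.continuous ?_ (measurable_deriv _)
    (fun t ht => (hK t ht).continuousWithinAt) (fun t ht => (hK' t ht).continuousWithinAt)
    (hg'c.congr hdw) (fun t ht => ?_) hU.equation
  · exact (measurable_id.add_const ε).pow_const _
  · rw [← hg₀, volterraConv_congr hdw (fun _ _ => rfl) ht]
    exact hid t ht
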